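/- **Setting.** A list arbdefective coloring instance on a graph $G=(V,E)$ gives every node $v$ a finite color list $L_v$ and a function $d_v:L_v\to\mathbb{N}_0$; a solution assigns to each node $v$ a color $x_v\in L_v$ and orients every monochromatic edge in one of its two directions such that every $v$ has at most $d_v(x_v)$ outneighbors of color $x_v$. The instance has slack $S$ if $\sum_{x\in L_v}(d_v(x)+1)>S\cdot\deg(v)$ for all $v\in V$. Let $P_A(S,C)$ be the family of all instances with slack (at least) $S$ and with all lists contained in a fixed set of $C$ colors. Let $\mathcal G$ be a class of finite graphs that is closed under isomorphism and under taking induced subgraphs. For $\Delta,q,N\in\mathbb{N}_0$ let $T_A^{(q)}(S,C)=T_A^{(\mathcal G,\Delta,q,N)}(S,C)$ denote the smallest number $T$ of rounds in which a deterministic algorithm in the LOCAL model solves all instances of $P_A(S,C)$ on all graphs of $\mathcal G$ of maximum degree at most $\Delta$. The nodes number their incident edges by ports and have unbounded local computation and message size. Each node initially knows its degree, its unique identifier from $\{0,\dots,N-1\}$, its color in a given proper $q$-vertex coloring, and its own list and allowed defects; it has to output its color and the orientation of its incident monochromatic edges. The algorithm may depend on $\mathcal G,\Delta,q,N,S,C$.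 All logarithms are to base $2$ (with $\log 0:=0$), and $\log^* n$ is the least $k\ge 0$ such that applying $\log$ to $n$ exactly $k$ times gives a value at most $1$. **Statement.** There is an absolute constant $c\in\mathbb{N}$ such that for every such class $\mathcal G$ and all $\Delta,q,N,C\in\mathbb{N}_0$, with $q':=\min\{q,\,c\,\Delta^2\}$, $$T_A^{(q)}(1,C)\;\le\; c\log\Delta\cdot\big(T_A^{(q')}(2,C)+\log^*\Delta\big)+c\log^* q,$$ and for every real $S\ge 1$, $$T_A^{(q)}(2,C)\;\le\; c\,S^2\cdot T_A^{(q')}(S,C)+c\log^* q .$$ (Since $T_A^{(q')}\le T_A^{(q)}$ for $q'\le q$, the same bounds hold with $T_A^{(q)}$ on the right-hand sides.) -/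

import Mathlib

open scoped ENNReal

/-- The iterated logarithm to base 2: the least `k` such that applying `log₂` to `n` exactly `k`
times gives a value at most `1`. -/
noncomputable def logStar (n : ℕ) : ℕ :=
  sInf {k : ℕ | (Real.logb 2)^[k] (n : ℝ) ≤ 1}

/-- The degree of a node. -/
noncomputable def nodeDegree {V : Type} (G : SimpleGraph V) (v : V) : ℕ :=
  (G.neighborSet v).ncard

/-! ### List arbdefective coloring -/

/-- The list arbdefective coloring instance with lists `L v` and (arb)defects `d v x`, `x ∈ L v`,
has slack `S`. (Values `d v x` with `x ∉ L v` are never used.) -/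
def HasSlack {V : Type} (G : SimpleGraph V) (L : V → Finset ℕ) (d : V → ℕ → ℕ) (S : ℝ) : Prop :=
  ∀ v, S * (nodeDegree G v : ℝ) < ∑ x ∈ L v, ((d v x : ℝ) + 1)

/-- The coloring `x` together with the orientation `out` (`out v u` says that the edge `{v, u}` is
oriented from `v` to `u`) solves the list arbdefective coloring instance `(L, d)`: every node has a
color of its list, every monochromatic edge is oriented in exactly one direction, and
every node `v` has at most `d v (x v)` outneighbors of its own color. -/
def IsListArbdefectiveColoring {V : Type} (G : SimpleGraph V) (L : V → Finset ℕ) (d : V → ℕ → ℕ)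
    (x : V → ℕ) (out : V → V → Prop) : Prop :=
  (∀ v, x v ∈ L v) ∧
  (∀ v u, G.Adj v u → x v = x u → (out v u ↔ ¬ out u v)) ∧
  (∀ v, {u | G.Adj v u ∧ x u = x v ∧ out v u}.ncard ≤ d v (x v))

/-! ### The deterministic LOCAL model -/

/-- A port numbering: every node `v` numbers its incident edges by `0, …, deg v - 1`. -/
abbrev PortNumbering {V : Type} (G : SimpleGraph V) : Type :=
  ∀ v : V, Fin (nodeDegree G v) ≃ G.neighborSet v

/-- The neighbor of `v` behind port `i`. -/
def PortNumbering.nbr {V : Type} {G : SimpleGraph V} (p : PortNumbering G) (v : V)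
    (i : Fin (nodeDegree G v)) : V :=
  (p v i : V)

/-- The number of the port of `v` that leads to its neighbor `u`. -/
def PortNumbering.portTo {V : Type} {G : SimpleGraph V} (p : PortNumbering G) (v u : V)
    (h : G.Adj v u) : ℕ :=
  ((p v).symm ⟨u, h⟩ : ℕ)

/-- A deterministic synchronous message passing algorithm with node inputs `I` and node outputs `O`.
Local computation and message size are unrestricted. In every round, a node sends the
message `send s i` through its port `i`, where `s` is its current state, and then updates its state
according to the list of the messages that it received, in the order of its ports. -/
structure LocalAlgorithm (I O : Type) where
  State : Type
  Msg : Type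
  init : I → State
  send : State → ℕ → Msg
  step : State → List Msg → State
  output : State → O

/-- The state of each node after `t` rounds. -/
noncomputable def LocalAlgorithm.state {I O : Type} (A : LocalAlgorithm I O) {V : Type} {G : SimpleGraph V}
    (p : PortNumbering G) (inp : V → I) : ℕ → V → A.State
  | 0, v => A.init (inp v)
  | t + 1, v =>
      A.step (A.state p inp t v)
        (List.ofFn fun i : Fin (nodeDegree G v) =>
          A.send (A.state p inp t (p.nbr v i)) (p.portTo (p.nbr v i) v (SimpleGraph.Adj.symm (p v i).2)))

/-- What a node knows initially: its identifier, its degree, its color in the given proper coloring,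
its color list and the allowed defects. -/
structure NodeInput where
  ident : ℕ
  degree : ℕ
  color : ℕ
  list : Finset ℕ
  defect : ℕ → ℕ

/-- What a node has to output: its color, and the set of ports whose edges it orients outwards. -/
structure NodeOutput where
  color : ℕ
  outPorts : Set ℕ

/-- A class of (finite) graphs. -/
abbrev GraphClass : Type 1 := ∀ V : Type, SimpleGraph V → Prop

/-- The class is closed under isomorphism and under taking induced subgraphs. -/
def GraphClass.Hereditary (𝒢 : GraphClass) : Prop :=
  ∀ (V W : Type) (G : SimpleGraph V) (H : SimpleGraph W), Nonempty (H ↪g G) → 𝒢 V G → 𝒢 W H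

/-- After `T` rounds, the algorithm `A` has solved every instance of the family `P_A(S, C)` (list
arbdefective coloring with slack at least `S` and colors from `{0, …, C - 1}`) on every finite graph
of the class `𝒢` with maximum degree at most `Δ`, for every port numbering, every assignment of
unique identifiers from `{0, …, N - 1}`, and every given proper `q`-coloring. -/
def LocalAlgorithm.SolvesPA (A : LocalAlgorithm NodeInput NodeOutput) (T : ℕ)
    (𝒢 : GraphClass) (Δ q N : ℕ) (S : ℝ) (C : ℕ) : Prop :=
  ∀ (V : Type) [Finite V] (G : SimpleGraph V), 𝒢 V G → (∀ v, nodeDegree G v ≤ Δ) →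
  ∀ (p : PortNumbering G) (ident : V ↪ Fin N) (col : G.Coloring (Fin q))
    (L : V → Finset ℕ) (d : V → ℕ → ℕ),
    (∀ v, L v ⊆ Finset.range C) → HasSlack G L d S →
    let inp : V → NodeInput := fun v =>
      { ident := (ident v : ℕ), degree := nodeDegree G v, color := (col v : ℕ),
        list := L v, defect := d v }
    let res : V → NodeOutput := fun v => A.output (A.state p inp T v)
    IsListArbdefectiveColoring G L d (fun v => (res v).color)
      (fun v u => ∃ h : G.Adj v u, p.portTo v u h ∈ (res v).outPorts)

/-- `T_A(S, C)`: the optimal number of rounds of a deterministic LOCAL algorithm for `P_A(S, C)` on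
the graphs of the class `𝒢` with maximum degree at most `Δ` that are equipped with a proper
`q`-coloring and with unique identifiers from a set of size `N`. The algorithm may depend on all
these parameters. -/
noncomputable def TA (𝒢 : GraphClass) (Δ q N : ℕ) (S : ℝ) (C : ℕ) : ℕ∞ :=
  ⨅ (T : ℕ) (_ : ∃ A : LocalAlgorithm NodeInput NodeOutput, A.SolvesPA T 𝒢 Δ q N S C), (T : ℕ∞)

/-!
Both bounds come from one procedure, a *phase*. A defective coloring splits the nodes into `O(α²)`
classes such that every uncolored node `v` has at most `deg v / α` uncolored neighbors in its own
class. The classes are processed one after the other. When its turn comes, an uncolored node reduces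
the defect of each color by the number of neighbors that already have this color and drops the
colors whose defect would become negative; this decreases the total weight `∑ (d x + 1)` of its list
by at most the number of colored neighbors (`sum_residual_ge`). If the residual weight exceeds `S`
times the number of uncolored neighbors in the class, the node takes part in a run of the given
algorithm for slack `S` on the subgraph induced by all such nodes. Edges to previously colored nodes
of the same color are oriented towards them, so solutions of the residual instances extend the
partial solution (`IsPartialColoring.extend`). Consequently, a node that stays uncolored has total
weight at most (number of colored neighbors at the end) + `S` · (number of initially uncolored
neighbors in its class), see `weight_le_of_uncolored`.

* With initial slack `2` and `α ≥ S`, this contradicts the slack: one phase colors all nodes, in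
  `O(S²)` runs of the algorithm (`TA_two_le`).
* With initial slack `1`, `S = 2` and `α = 4`, a node that stays uncolored has lost more than half
  of its uncolored neighbors, so `O(log Δ)` phases suffice (`TA_one_le`).

The defective coloring (`exists_reducesColors`) is computed from a proper `m`-coloring in
`O(log* m)` rounds. In each round a node regards its color as a polynomial of degree at most `k`
over a field with `p` elements, and moves to a point of the graph of this polynomial that few
polynomials of its neighbors share; on average over the field, a neighbor shares a point with
probability at most `k / p` (`reducesColors_sq`). The choice `α = Δ + 1` leaves no monochromatic
edge and reduces the initial `q`-coloring to `O(Δ²)` colors.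

A phase needs `O(1)` additional rounds per class. For the second bound this overhead is absorbed by
the running time for slack `S`, which is positive except in trivial cases (`not_solvesPA_zero`).

The algorithms are not written down as state machines: `RunsIn T F` says that the map `F` from node
labelings to node labelings is computable in `T` rounds, and the closure properties of this
predicate (composition, reading the labels of the neighbors, running an algorithm on an induced
subgraph) are all that is used.
-/

/-! ### Maps on networks that are computable in a given number of rounds -/

/-- A map from node labelings to node labelings, defined uniformly on all networks (graphs with a
port numbering). -/
abbrev NetMap (X Y : Type) : Type 1 :=
  ∀ ⦃V : Type⦄ ⦃G : SimpleGraph V⦄, PortNumbering G → (V → X) → V → Y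

/-- Some algorithm in the LOCAL model outputs `F p s v` at every node `v` after exactly `T` rounds,
on every network `p` and for all node inputs `s`. -/
def RunsIn {X Y : Type} (T : ℕ) (F : NetMap X Y) : Prop :=
  ∃ A : LocalAlgorithm X Y, ∀ ⦃V : Type⦄ ⦃G : SimpleGraph V⦄ (p : PortNumbering G) (s : V → X)
    (v : V), A.output (A.state p s T v) = F p s v

namespace RunsIn

variable {X Y Z : Type}

theorem of_algorithm (A : LocalAlgorithm X Y) (T : ℕ) :
    RunsIn T (fun _ _ p s v => A.output (A.state p s T v)) :=
  ⟨A, fun _ _ _ _ _ => rfl⟩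

theorem pure (f : X → Y) : RunsIn 0 (fun _ _ _ s v => f (s v)) :=
  ⟨{ State := X, Msg := Unit, init := id, send := fun _ _ => (), step := fun s _ => s,
     output := f }, fun _ _ _ _ _ => rfl⟩

/-- One round suffices to learn the labels of all neighbors, in the order of the ports. -/
theorem round (f : X → List X → Y) :
    RunsIn 1 (fun _ _ p s v => f (s v) (List.ofFn fun i => s (p.nbr v i))) :=
  ⟨{ State := X × List X, Msg := X, init := fun x => (x, []), send := fun s _ => s.1,
     step := fun s l => (s.1, l), output := fun s => f s.1 s.2 }, fun _ _ _ _ _ => rfl⟩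

theorem pair {T : ℕ} {F : NetMap X Y} {F' : NetMap X Z} (h : RunsIn T F) (h' : RunsIn T F') :
    RunsIn T (fun _ _ p s v => (F p s v, F' p s v)) := by
  obtain ⟨A, hA⟩ := h
  obtain ⟨B, hB⟩ := h'
  let D : LocalAlgorithm X (Y × Z) :=
    { State := A.State × B.State
      Msg := A.Msg × B.Msg
      init := fun x => (A.init x, B.init x)
      send := fun s i => (A.send s.1 i, B.send s.2 i)
      step := fun s l => (A.step s.1 (l.map Prod.fst), B.step s.2 (l.map Prod.snd))
      output := fun s => (A.output s.1, B.output s.2) }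
  have key : ∀ ⦃V : Type⦄ ⦃G : SimpleGraph V⦄ (p : PortNumbering G) (s : V → X) (t : ℕ) (v : V),
      D.state p s t v = (A.state p s t v, B.state p s t v) := by
    intro V G p s t
    induction t with
    | zero => intro v; rfl
    | succ t ih =>
      intro v
      simp only [LocalAlgorithm.state, ih]
      simp only [D, List.map_ofFn]
      rfl
  refine ⟨D, fun V G p s v => ?_⟩
  rw [key]
  exact Prod.ext (hA p s v) (hB p s v)

theorem comp {T T' : ℕ} {F : NetMap X Y} {F' : NetMap Y Z} (h : RunsIn T F) (h' : RunsIn T' F') :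
    RunsIn (T + T') (fun _ _ p s => F' p (F p s)) := by
  classical
  obtain ⟨A, hA⟩ := h
  obtain ⟨B, hB⟩ := h'
  -- The state is `inl (t, a)` in round `t < T`, while `A` is running, and `inr b` from then on.
  let switch : ℕ → A.State → (ℕ × A.State) ⊕ B.State := fun n a =>
    if n = T then Sum.inr (B.init (A.output a)) else Sum.inl (n, a)
  let D : LocalAlgorithm X Z :=
    { State := (ℕ × A.State) ⊕ B.State
      Msg := A.Msg ⊕ B.Msg
      init := fun x => switch 0 (A.init x)
      send := fun s i => s.map (fun a => A.send a.2 i) (fun b => B.send b i)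
      step := fun s l => s.elim
        (fun a => switch (a.1 + 1) (A.step a.2 (l.filterMap Sum.getLeft?)))
        (fun b => Sum.inr (B.step b (l.filterMap Sum.getRight?)))
      output := fun s => s.elim (fun a => B.output (B.init (A.output a.2))) B.output }
  refine ⟨D, fun V G p s v => ?_⟩
  have h1 : ∀ t, t ≤ T → ∀ v, D.state p s t v = switch t (A.state p s t v) := by
    intro t
    induction t with
    | zero => intro _ v; rfl
    | succ t ih =>
      intro ht v
      have hs : ∀ v, D.state p s t v = Sum.inl (t, A.state p s t v) := fun v => by
        rw [ih (by omega) v]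
        exact if_neg (by omega)
      simp only [LocalAlgorithm.state, hs]
      change switch (t + 1) (A.step _ (List.filterMap Sum.getLeft? (List.ofFn _))) = _
      congr 2
      rw [← List.map_id (List.ofFn fun i => A.send _ _), ← List.filterMap_eq_map,
        List.ofFn_eq_map, List.ofFn_eq_map, List.filterMap_map, List.filterMap_map]
      rfl
  have h2 : ∀ t v, D.state p s (T + t) v = Sum.inr (B.state p (F p s) t v) := by
    intro t
    induction t with
    | zero =>
      intro v
      rw [Nat.add_zero, h1 T le_rfl v]
      simp only [switch, if_true, hA]
      rfl
    | succ t ih =>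
      intro v
      rw [← Nat.add_assoc]
      simp only [LocalAlgorithm.state, ih]
      change Sum.inr (B.step _ (List.filterMap Sum.getRight? (List.ofFn _))) = _
      congr 2
      rw [← List.map_id (List.ofFn fun i => B.send _ _), ← List.filterMap_eq_map,
        List.ofFn_eq_map, List.ofFn_eq_map, List.filterMap_map, List.filterMap_map]
      rfl
  rw [h2 T' v]
  exact hB p _ v

theorem map {T : ℕ} {F : NetMap X Y} (h : RunsIn T F) (f : Y → Z) :
    RunsIn T (fun _ _ p s v => f (F p s v)) :=
  h.comp (pure f)

theorem wait (T : ℕ) : RunsIn T (fun _ _ _ (s : _ → X) v => s v) := by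
  induction T with
  | zero => exact pure id
  | succ T ih => exact ih.comp (round fun x _ => x)

/-- The inputs of a subroutine stay available next to its outputs. -/
theorem keep {T : ℕ} {F : NetMap X Y} (h : RunsIn T F) :
    RunsIn T (fun _ _ p s v => (s v, F p s v)) :=
  (wait T).pair h

/-- Composition in which the second map also reads the original labels. -/
theorem comp_keep {T T' : ℕ} {F : NetMap X Y} {F' : NetMap (X × Y) Z} (h : RunsIn T F)
    (h' : RunsIn T' F') : RunsIn (T + T') (fun _ _ p s => F' p fun v => (s v, F p s v)) :=
  h.keep.comp h'

end RunsIn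

/-! ### Neighbors and port numberings -/

section Neighbors

variable {V : Type} {G : SimpleGraph V}

/-- The number of neighbors of `v` with property `P`. -/
noncomputable def nbrCount (G : SimpleGraph V) (v : V) (P : V → Prop) : ℕ :=
  {u | G.Adj v u ∧ P u}.ncard

theorem PortNumbering.finite_neighborSet (p : PortNumbering G) (v : V) :
    (G.neighborSet v).Finite :=
  Set.finite_coe_iff.mp (Finite.of_equiv _ (p v))

theorem PortNumbering.nbr_adj (p : PortNumbering G) (v : V) (i : Fin (nodeDegree G v)) :
    G.Adj v (p.nbr v i) :=
  (p v i).2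

theorem PortNumbering.nbr_injective (p : PortNumbering G) (v : V) :
    Function.Injective (p.nbr v) :=
  fun _ _ h => (p v).injective (Subtype.ext h)

theorem PortNumbering.portTo_lt (p : PortNumbering G) {v u : V} (h : G.Adj v u) :
    p.portTo v u h < nodeDegree G v :=
  ((p v).symm ⟨u, h⟩).2

theorem PortNumbering.nbr_portTo (p : PortNumbering G) {v u : V} (h : G.Adj v u) :
    p.nbr v ⟨p.portTo v u h, p.portTo_lt h⟩ = u := by
  simp [PortNumbering.nbr, PortNumbering.portTo]

theorem PortNumbering.portTo_eq (p : PortNumbering G) {v u : V} (h : G.Adj v u)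
    {i : Fin (nodeDegree G v)} (hi : p.nbr v i = u) : p.portTo v u h = i := by
  have := p.nbr_injective v (hi.trans (p.nbr_portTo h).symm)
  rw [this]

theorem PortNumbering.countP_nbr (p : PortNumbering G) {X : Type} (s : V → X) (v : V)
    (P : X → Bool) :
    (List.ofFn fun i => s (p.nbr v i)).countP P = nbrCount G v fun u => P (s u) = true := by
  classical
  have h1 : (List.ofFn fun i => s (p.nbr v i)).countP P
      = (Finset.univ.filter fun i => P (s (p.nbr v i)) = true).card := by
    rw [List.ofFn_eq_map, List.countP_map, List.countP_eq_length_filter,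
      ← List.toFinset_card_of_nodup ((List.nodup_finRange _).filter _)]
    congr 1
    ext i
    simp
  have h2 : {u | G.Adj v u ∧ P (s u) = true}
      = p.nbr v '' (Finset.univ.filter fun i => P (s (p.nbr v i)) = true : Finset _) := by
    ext u
    constructor
    · rintro ⟨h, hu⟩
      refine ⟨⟨p.portTo v u h, p.portTo_lt h⟩, ?_, p.nbr_portTo h⟩
      simpa [p.nbr_portTo h] using hu
    · rintro ⟨i, hi, rfl⟩
      exact ⟨p.nbr_adj v i, by simpa using hi⟩
  rw [h1, nbrCount, h2, Set.ncard_image_of_injective _ (p.nbr_injective v), Set.ncard_coe_finset]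

theorem nbrCount_mono {v : V} (hf : (G.neighborSet v).Finite) {P Q : V → Prop}
    (h : ∀ u, G.Adj v u → P u → Q u) : nbrCount G v P ≤ nbrCount G v Q :=
  Set.ncard_le_ncard (fun u hu => ⟨hu.1, h u hu.1 hu.2⟩) (hf.subset fun _ hu => hu.1)

theorem nbrCount_le_degree {v : V} (hf : (G.neighborSet v).Finite) (P : V → Prop) :
    nbrCount G v P ≤ nodeDegree G v :=
  Set.ncard_le_ncard (fun _ hu => hu.1) hf

theorem nbrCount_or_le {v : V} (P Q : V → Prop) :
    nbrCount G v (fun u => P u ∨ Q u) ≤ nbrCount G v P + nbrCount G v Q := by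
  unfold nbrCount
  refine le_trans (le_of_eq ?_) (Set.ncard_union_le _ _)
  congr 1
  ext u
  exact and_or_left

theorem nbrCount_add_not {v : V} (hf : (G.neighborSet v).Finite) (P : V → Prop) :
    nbrCount G v P + nbrCount G v (fun u => ¬ P u) = nodeDegree G v := by
  unfold nbrCount nodeDegree
  rw [← Set.ncard_union_eq _ (hf.subset fun _ hu => hu.1) (hf.subset fun _ hu => hu.1)]
  · congr 1
    ext u
    by_cases h : P u <;> simp [h]
  · rw [Set.disjoint_left]
    exact fun u hu hu' => hu'.2 hu.2

end Neighbors

/-! ### Running an algorithm on an induced subgraph -/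

section Subgraph

variable {V : Type} {G : SimpleGraph V}

open Classical in
/-- The ports of `v` that lead into `W`, in increasing order. -/
noncomputable def PortNumbering.portsInto (p : PortNumbering G) (W : Set V) (v : V) : List ℕ :=
  (List.range (nodeDegree G v)).filter fun i => ∃ h : i < nodeDegree G v, p.nbr v ⟨i, h⟩ ∈ W

theorem PortNumbering.mem_portsInto {p : PortNumbering G} {W : Set V} {v : V} {i : ℕ} :
    i ∈ p.portsInto W v ↔ ∃ h : i < nodeDegree G v, p.nbr v ⟨i, h⟩ ∈ W := by
  simp only [PortNumbering.portsInto, List.mem_filter, List.mem_range, decide_eq_true_eq]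
  exact ⟨fun h => h.2, fun h => ⟨h.1, h⟩⟩

theorem PortNumbering.nodup_portsInto (p : PortNumbering G) (W : Set V) (v : V) :
    (p.portsInto W v).Nodup :=
  List.nodup_range.filter _

theorem PortNumbering.exists_of_portsInto (p : PortNumbering G) (W : Set V) (v : V)
    (j : Fin (p.portsInto W v).length) :
    ∃ h : (p.portsInto W v)[j] < nodeDegree G v, p.nbr v ⟨(p.portsInto W v)[j], h⟩ ∈ W :=
  PortNumbering.mem_portsInto.mp (List.getElem_mem j.2)

/-- The neighbors of `w` in `G.induce W`, numbered by the increasing list of ports into `W`. -/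
noncomputable def PortNumbering.subEquiv (p : PortNumbering G) (W : Set V) (w : W) :
    Fin (p.portsInto W w).length ≃ (G.induce W).neighborSet w :=
  Equiv.ofBijective
    (fun j => ⟨⟨p.nbr w ⟨(p.portsInto W w)[j], (p.exists_of_portsInto W w j).1⟩,
      (p.exists_of_portsInto W w j).2⟩, p.nbr_adj w _⟩) <| by
    constructor
    · intro j j' h
      have h1 := p.nbr_injective w (congrArg (fun x => (x.1.1 : V)) h)
      have h2 : (p.portsInto W w)[j] = (p.portsInto W w)[j'] := congrArg Fin.val h1
      exact Fin.ext (((p.nodup_portsInto W w).getElem_inj_iff).mp h2)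
    · rintro ⟨⟨u, hu⟩, h⟩
      have hadj : G.Adj w u := h
      have hm : p.portTo w u hadj ∈ p.portsInto W w :=
        PortNumbering.mem_portsInto.mpr ⟨p.portTo_lt hadj, by rwa [p.nbr_portTo hadj]⟩
      obtain ⟨j, hj, hj'⟩ := List.getElem_of_mem hm
      refine ⟨⟨j, hj⟩, Subtype.ext (Subtype.ext ?_)⟩
      simp only [Fin.getElem_fin, hj', p.nbr_portTo hadj]

theorem PortNumbering.nodeDegree_induce (p : PortNumbering G) (W : Set V) (w : W) :
    nodeDegree (G.induce W) w = (p.portsInto W w).length := by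
  have := Nat.card_congr (p.subEquiv W w)
  rw [Nat.card_fin] at this
  exact this.symm

/-- The port numbering of an induced subgraph that keeps the order of the ports. -/
noncomputable def PortNumbering.induce (p : PortNumbering G) (W : Set V) :
    PortNumbering (G.induce W) :=
  fun w => (finCongr (p.nodeDegree_induce W w)).trans (p.subEquiv W w)

theorem PortNumbering.portTo_induce (p : PortNumbering G) (W : Set V) {w u : W}
    (h : (G.induce W).Adj w u) :
    (p.induce W).portTo w u h = (p.portsInto W w).idxOf (p.portTo (w : V) u h) := by
  obtain ⟨j, hj⟩ := (p.subEquiv W w).surjective ⟨u, h⟩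
  have h1 : (p.induce W).portTo w u h = j := by
    refine (p.induce W).portTo_eq h (i := (finCongr (p.nodeDegree_induce W w)).symm j) ?_
    simp [PortNumbering.nbr, PortNumbering.induce, hj]
  have h2 : p.portTo (w : V) u h = (p.portsInto W w)[j] :=
    p.portTo_eq (i := ⟨_, (p.exists_of_portsInto W w j).1⟩) h
      (congrArg (fun x => (x.1.1 : V)) hj)
  rw [h1, h2]
  exact ((p.nodup_portsInto W w).idxOf_getElem j j.2).symm

theorem nodeDegree_induce_eq (W : Set V) (w : W) :
    nodeDegree (G.induce W) w = nbrCount G w fun u => u ∈ W := by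
  unfold nodeDegree nbrCount
  rw [← Set.ncard_image_of_injective _ Subtype.val_injective]
  congr 1
  ext u
  simp [and_comm]

/-- Reading the messages of the active neighbors only, in the order of the ports, gives the messages
of the neighbors in the induced subgraph, in the order of its ports. -/
theorem PortNumbering.filterMap_ofFn_induce (p : PortNumbering G) (W : Set V) (w : W) {M : Type}
    (f : V → Option M) (g : W → M) (hf : ∀ u : W, (G.induce W).Adj w u → f u = some (g u))
    (hf' : ∀ u, u ∉ W → f u = none) :
    (List.ofFn fun i => f (p.nbr w i)).filterMap id
      = List.ofFn fun j => g ((p.induce W).nbr w j) := by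
  classical
  -- `F` extends `fun i => f (p.nbr w i)` to all natural numbers.
  let F : ℕ → Option M := fun i =>
    if h : i < nodeDegree G w then f (p.nbr w ⟨i, h⟩) else none
  have h1 : (List.ofFn fun i => f (p.nbr w i))
      = (List.range (nodeDegree G w)).map F := by
    apply List.ext_getElem <;> simp +contextual [F]
  have h2 : ∀ L : List ℕ, (L.map F).filterMap id
      = ((L.filter fun i => ∃ h : i < nodeDegree G w, p.nbr w ⟨i, h⟩ ∈ W).map F).filterMap id := by
    intro L
    induction L with
    | nil => rfl
    | cons i L ih =>
      by_cases hi : ∃ h : i < nodeDegree G w, p.nbr w ⟨i, h⟩ ∈ W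
      · rw [List.filter_cons_of_pos (by simpa using hi)]
        simp only [List.map_cons, List.filterMap_cons, ih]
      · rw [List.filter_cons_of_neg (by simpa using hi), ← ih]
        have : F i = none := by
          by_cases h : i < nodeDegree G w
          · simp only [F, dif_pos h]
            exact hf' _ fun h' => hi ⟨h, h'⟩
          · simp only [F, dif_neg h]
        simp only [List.map_cons, List.filterMap_cons, this, id]
  rw [h1, h2]
  change ((p.portsInto W w).map F).filterMap id = _
  have h3 : (p.portsInto W w).map F
      = (List.ofFn fun j => g ((p.induce W).nbr w j)).map some := by
    apply List.ext_getElem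
    · simp [p.nodeDegree_induce]
    · intro j hj hj'
      have hj1 : j < (p.portsInto W w).length := by simpa using hj
      obtain ⟨h, h'⟩ := p.exists_of_portsInto W w ⟨j, hj1⟩
      simp only [List.getElem_map, List.getElem_ofFn]
      simp only [F]
      exact (dif_pos h).trans (hf ⟨_, h'⟩ (p.nbr_adj w _))
  rw [h3, List.filterMap_map]
  simp

end Subgraph

namespace RunsIn

variable {X Y : Type}

open Classical in
/-- The active nodes, those with an input `some x`, run a `T`-round algorithm on the subgraph that
they induce. Every active node also learns which of its ports lead to active nodes. -/
theorem onActive (A : LocalAlgorithm X Y) (T : ℕ) :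
    RunsIn (T + 1) (fun V _ p (s : V → Option X) v =>
      if h : (s v).isSome then
        some (A.output (A.state (p.induce {u | (s u).isSome}) (fun w => (s w).get w.2) T ⟨v, h⟩),
          p.portsInto {u | (s u).isSome} v)
      else none) := by
  -- The first round collects the active ports.
  have h1 : RunsIn 1 (fun V _ p (s : V → Option X) v =>
      (s v, p.portsInto {u | (s u).isSome} v)) := by
    obtain ⟨A, hA⟩ := RunsIn.round fun (x : Option X) l =>
      (x, (List.range l.length).filter fun i => (l[i]?.getD none).isSome)
    refine ⟨A, fun V G p s v => ?_⟩
    rw [hA]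
    refine Prod.ext rfl ?_
    simp only [PortNumbering.portsInto, List.length_ofFn]
    refine List.filter_congr fun i hi => ?_
    rw [List.mem_range] at hi
    rw [List.getElem?_eq_getElem (by simpa using hi)]
    simp [hi]
  let D : LocalAlgorithm (Option X × List ℕ) (Option (Y × List ℕ)) :=
    { State := Option A.State × List ℕ
      Msg := Option A.Msg
      init := fun x => (x.1.map A.init, x.2)
      send := fun s i => s.1.map fun a => A.send a (s.2.idxOf i)
      step := fun s l => (s.1.map fun a => A.step a (l.filterMap id), s.2)
      output := fun s => s.1.map fun a => (A.output a, s.2) }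
  have h2 := h1.comp (RunsIn.of_algorithm D T)
  rw [Nat.add_comm]
  obtain ⟨B, hB⟩ := h2
  refine ⟨B, fun V G p s v => ?_⟩
  rw [hB]
  clear hB B
  set W : Set V := {u | (s u).isSome} with hW
  have key : ∀ t v, D.state p (fun v => (s v, p.portsInto W v)) t v =
      (if h : v ∈ W then some (A.state (p.induce W) (fun w => (s w).get w.2) t ⟨v, h⟩) else none,
        p.portsInto W v) := by
    intro t
    induction t with
    | zero =>
      intro v
      refine Prod.ext ?_ rfl
      change (s v).map A.init = _
      by_cases h : v ∈ W
      · rw [dif_pos h]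
        obtain ⟨x, hx⟩ := Option.isSome_iff_exists.mp h
        simp [LocalAlgorithm.state, hx]
      · rw [dif_neg h]
        have : s v = none := by simpa [hW] using h
        rw [this]; rfl
    | succ t ih =>
      intro v
      simp only [LocalAlgorithm.state, ih]
      refine Prod.ext ?_ rfl
      by_cases h : v ∈ W
      · simp only [D, dif_pos h, Option.map_some]
        congr 2
        let f : V → Option A.Msg := fun u => if hu : G.Adj u v then
            (if h : u ∈ W then some (A.state (p.induce W) (fun w => (s w).get w.2) t ⟨u, h⟩)
              else none).map fun a => A.send a ((p.portsInto W u).idxOf (p.portTo u v hu))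
          else none
        let g : W → A.Msg := fun u => if hu : (G.induce W).Adj u ⟨v, h⟩ then
            A.send (A.state (p.induce W) (fun w => (s w).get w.2) t u)
              ((p.induce W).portTo u ⟨v, h⟩ hu)
          else A.send (A.state (p.induce W) (fun w => (s w).get w.2) t u) 0
        have := p.filterMap_ofFn_induce W ⟨v, h⟩ f g ?_ ?_
        · convert this using 3
          · funext i
            simp only [f]
            rw [dif_pos (p.nbr_adj v i).symm]
          · simp only [g]
            rw [dif_pos ((p.induce W).nbr_adj ⟨v, h⟩ _).symm]
        · intro u hu
          simp only [f, g]
          rw [dif_pos (show G.Adj u v from hu.symm), dif_pos u.2, dif_pos hu.symm,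
            p.portTo_induce]
          rfl
        · intro u hu
          simp only [f, dif_neg hu, Option.map_none, dite_eq_ite, ite_self]
      · simp only [D, dif_neg h, Option.map_none]
  refine (congrArg D.output (key T v)).trans ?_
  by_cases h : v ∈ W
  · have h' : (s v).isSome := h
    simp only [D, dif_pos h, dif_pos h', Option.map_some]
    rfl
  · have h' : ¬ (s v).isSome := h
    simp only [D, dif_neg h, dif_neg h', Option.map_none]

end RunsIn

/-! ### Partial solutions and residual instances -/

section Partial

variable {V : Type} {G : SimpleGraph V}

/-- A solution of the instance `(L, d)` on the nodes that already have a color `x v = some c`. The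
orientation of their edges to uncolored neighbors is fixed as well: these edges are directed towards
the colored node. -/
structure IsPartialColoring (G : SimpleGraph V) (L : V → Finset ℕ) (d : V → ℕ → ℕ)
    (x : V → Option ℕ) (out : V → V → Prop) : Prop where
  mem : ∀ v c, x v = some c → c ∈ L v
  orient : ∀ v u c, G.Adj v u → x v = some c → x u = some c → (out v u ↔ ¬ out u v)
  not_out : ∀ v u, G.Adj v u → x v ≠ none → x u = none → ¬ out v u
  count : ∀ v c, x v = some c → nbrCount G v (fun u => x u = some c ∧ out v u) ≤ d v c

/-- A partial solution is extended by a solution of an instance on a set `W` of uncolored nodes, if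
the defects on `W` are reduced by the number of neighbors that already have the color in question.
Edges from `W` to previously colored nodes are oriented away from `W`. -/
theorem IsPartialColoring.extend {L : V → Finset ℕ} {d : V → ℕ → ℕ} {x : V → Option ℕ}
    {out : V → V → Prop} (h : IsPartialColoring G L d x out)
    (hf : ∀ v, (G.neighborSet v).Finite) {W : Set V} (hW : ∀ v ∈ W, x v = none)
    {L' : W → Finset ℕ} {d' : W → ℕ → ℕ} {y : W → ℕ} {outW : W → W → Prop}
    (hs : IsListArbdefectiveColoring (G.induce W) L' d' y outW)
    (hL : ∀ (w : W), ∀ c ∈ L' w, c ∈ L w ∧ nbrCount G w (fun u => x u = some c) + d' w c ≤ d w c)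
    {x' : V → Option ℕ} {out' : V → V → Prop}
    (hx : ∀ w : W, x' w = some (y w)) (hx' : ∀ v, v ∉ W → x' v = x v)
    (ho : ∀ (w : W) (u : V), G.Adj w u → (out' w u ↔ x u ≠ none ∨ ∃ hu : u ∈ W, outW w ⟨u, hu⟩))
    (ho' : ∀ v, v ∉ W → x v ≠ none → ∀ u, G.Adj v u → (out' v u ↔ out v u)) :
    IsPartialColoring G L d x' out' := by
  obtain ⟨hs1, hs2, hs3⟩ := hs
  have hcross : ∀ (w : W) (u : V) (c : ℕ), G.Adj w u → u ∉ W → x' u = some c →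
      out' w u ∧ ¬ out' u w := by
    intro w u c hadj hu hc
    rw [hx' u hu] at hc
    have hne : x u ≠ none := by simp [hc]
    refine ⟨(ho w u hadj).mpr (Or.inl hne), fun h' => ?_⟩
    exact h.not_out u w hadj.symm hne (hW _ w.2) ((ho' u hu hne _ hadj.symm).mp h')
  refine ⟨fun v c hc => ?_, fun v u c hadj hv hu => ?_, fun v u hadj hv hu => ?_,
    fun v c hc => ?_⟩
  · by_cases hv : v ∈ W
    · have := hx ⟨v, hv⟩
      rw [hc] at this
      rw [Option.some.inj this]
      exact (hL ⟨v, hv⟩ _ (hs1 _)).1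
    · exact h.mem v c (hx' v hv ▸ hc)
  · by_cases hvW : v ∈ W
    · by_cases huW : u ∈ W
      · have h1 : y ⟨v, hvW⟩ = y ⟨u, huW⟩ := by
          have a := hx ⟨v, hvW⟩
          have b := hx ⟨u, huW⟩
          rw [hv] at a
          rw [hu] at b
          exact (Option.some.inj a).symm.trans (Option.some.inj b)
        have h2 := hs2 ⟨v, hvW⟩ ⟨u, huW⟩ hadj h1
        have a := ho ⟨v, hvW⟩ u hadj
        have b := ho ⟨u, huW⟩ v hadj.symm
        simp only [hW v hvW, hW u huW, ne_eq, not_true_eq_false, false_or, hvW, huW,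
          exists_true_left] at a b
        rw [a, b, h2]
      · have := hcross ⟨v, hvW⟩ u c hadj huW hu
        exact iff_of_true this.1 this.2
    · by_cases huW : u ∈ W
      · have := hcross ⟨u, huW⟩ v c hadj.symm hvW hv
        exact iff_of_false this.2 (not_not.mpr this.1)
      · rw [hx' v hvW] at hv
        rw [hx' u huW] at hu
        rw [ho' v hvW (by simp [hv]) u hadj, ho' u huW (by simp [hu]) v hadj.symm]
        exact h.orient v u c hadj hv hu
  · have huW : u ∉ W := fun huW => by simp [hx ⟨u, huW⟩] at hu
    rw [hx' u huW] at hu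
    by_cases hvW : v ∈ W
    · rw [ho ⟨v, hvW⟩ u hadj]
      rintro (h1 | ⟨h1, -⟩)
      · exact h1 hu
      · exact huW h1
    · rw [hx' v hvW] at hv
      rw [ho' v hvW hv u hadj]
      exact h.not_out v u hadj hv hu
  · by_cases hvW : v ∈ W
    · have hcy : y ⟨v, hvW⟩ = c := by
        have a := hx ⟨v, hvW⟩
        rw [hc] at a
        exact (Option.some.inj a).symm
      have h1 := hs3 ⟨v, hvW⟩
      have h2 := (hL ⟨v, hvW⟩ _ (hs1 _)).2
      rw [hcy] at h1 h2
      refine le_trans ?_ h2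
      have h3 : nbrCount G v (fun u => ∃ hu : u ∈ W, y ⟨u, hu⟩ = c ∧ outW ⟨v, hvW⟩ ⟨u, hu⟩)
          ≤ d' ⟨v, hvW⟩ c := by
        refine le_trans (le_of_eq ?_) h1
        unfold nbrCount
        rw [← Set.ncard_image_of_injective _ Subtype.val_injective]
        congr 1
        ext u
        constructor
        · rintro ⟨hadj, huW, h4, h5⟩
          exact ⟨⟨u, huW⟩, ⟨hadj, h4, h5⟩, rfl⟩
        · rintro ⟨u, ⟨hadj, h4, h5⟩, rfl⟩
          exact ⟨hadj, u.2, h4, h5⟩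
      refine le_trans (le_trans (nbrCount_mono (hf v) ?_) (nbrCount_or_le _ _))
        (Nat.add_le_add_left h3 _)
      rintro u hadj ⟨hu, hout⟩
      by_cases huW : u ∈ W
      · rcases (ho ⟨v, hvW⟩ u hadj).mp hout with h6 | ⟨_, h6⟩
        · exact absurd (hW u huW) h6
        · refine Or.inr ⟨huW, ?_, h6⟩
          have a := hx ⟨u, huW⟩
          rw [hu] at a
          exact (Option.some.inj a).symm
      · exact Or.inl (hx' u huW ▸ hu)
    · rw [hx' v hvW] at hc
      refine le_trans (nbrCount_mono (hf v) ?_) (h.count v c hc)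
      rintro u hadj ⟨hu, hout⟩
      have hout' := (ho' v hvW (by simp [hc]) u hadj).mp hout
      have huW : u ∉ W := fun huW =>
        h.not_out v u hadj (by simp [hc]) (hW u huW) hout'
      exact ⟨hx' u huW ▸ hu, hout'⟩

theorem IsPartialColoring.isListArbdefectiveColoring {L : V → Finset ℕ} {d : V → ℕ → ℕ}
    {x : V → ℕ} {out : V → V → Prop} (h : IsPartialColoring G L d (fun v => some (x v)) out) :
    IsListArbdefectiveColoring G L d x out := by
  refine ⟨fun v => h.mem v _ rfl, fun v u hadj hvu => ?_, fun v => ?_⟩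
  · exact h.orient v u (x v) hadj rfl (by rw [hvu])
  · refine le_trans (le_of_eq ?_) (h.count v _ rfl)
    simp [nbrCount]

/-- Every colored neighbor decreases the residual total weight of the list by at most one. -/
theorem sum_residual_ge {v : V} (hf : (G.neighborSet v).Finite) (L : Finset ℕ) (d : ℕ → ℕ)
    (x : V → Option ℕ) :
    ∑ c ∈ L, ((d c : ℝ) + 1) - nbrCount G v (fun u => x u ≠ none)
      ≤ ∑ c ∈ L.filter (fun c => nbrCount G v (fun u => x u = some c) ≤ d c),
          (((d c - nbrCount G v (fun u => x u = some c) : ℕ) : ℝ) + 1) := by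
  classical
  have h1 : ∑ c ∈ L, nbrCount G v (fun u => x u = some c) ≤ nbrCount G v (fun u => x u ≠ none) := by
    let N : (V → Prop) → Finset V := fun P =>
      (hf.subset fun _ hu => hu.1 : {u | G.Adj v u ∧ P u}.Finite).toFinset
    have hN : ∀ P u, u ∈ N P ↔ G.Adj v u ∧ P u := fun P u => Set.Finite.mem_toFinset _
    have hcard : ∀ P : V → Prop, nbrCount G v P = (N P).card := fun P =>
      Set.ncard_eq_toFinset_card _ _
    simp only [hcard]
    rw [← Finset.card_biUnion]
    · refine Finset.card_le_card fun u hu => ?_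
      obtain ⟨c, -, hc⟩ := Finset.mem_biUnion.mp hu
      rw [hN] at hc ⊢
      exact ⟨hc.1, by simp [hc.2]⟩
    · intro c _ c' _ hcc'
      rw [Function.onFun, Finset.disjoint_left]
      intro u hu hu'
      rw [hN] at hu hu'
      exact hcc' (Option.some.inj (hu.2.symm.trans hu'.2))
  have h2 : (∑ c ∈ L, (nbrCount G v (fun u => x u = some c) : ℝ))
      ≤ nbrCount G v (fun u => x u ≠ none) := by exact_mod_cast h1
  rw [Finset.sum_filter]
  refine le_trans (sub_le_sub_left h2 _) ?_
  rw [← Finset.sum_sub_distrib]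
  refine Finset.sum_le_sum fun c _ => ?_
  split_ifs with hc
  · rw [Nat.cast_sub hc]
    linarith
  · have : (d c : ℝ) + 1 ≤ nbrCount G v (fun u => x u = some c) := by
      exact_mod_cast Nat.lt_of_not_le hc
    linarith

end Partial

/-! ### Coloring one class of nodes -/

namespace RunsIn

/-- In one round, a node can count its neighbors by any property of their labels. -/
theorem count (X : Type) :
    RunsIn 1 (fun _ G _ (s : _ → X) v (P : X → Bool) => nbrCount G v fun u => P (s u) = true) := by
  obtain ⟨A, hA⟩ := RunsIn.round fun (_ : X) l (P : X → Bool) => l.countP P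
  refine ⟨A, fun V G p s v => ?_⟩
  rw [hA]
  funext P
  exact p.countP_nbr s v P

/-- In one round, a node learns which of its ports lead to a neighbor whose label has a given
property. -/
theorem ports {X : Type} (P : X → Prop) :
    RunsIn 1 (fun _ G p (s : _ → X) v =>
      {i : ℕ | ∃ h : i < nodeDegree G v, P (s (p.nbr v ⟨i, h⟩))}) := by
  obtain ⟨A, hA⟩ := RunsIn.round fun (_ : X) l => {i : ℕ | ∃ h : i < l.length, P l[i]}
  refine ⟨A, fun V G p s v => ?_⟩
  rw [hA]
  ext i
  simp

end RunsIn

/-- What a node stores while the coloring is computed: its input, its output as soon as it is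
colored, and a class that determines when it tries to get colored. -/
structure NodeState where
  inp : NodeInput
  out : Option NodeOutput
  cls : ℕ

/-- The color of a node, if it is already colored. -/
def NodeState.col (n : NodeState) : Option ℕ := n.out.map NodeOutput.color

theorem NodeState.col_eq_none {n : NodeState} : n.col = none ↔ n.out = none := by
  simp [NodeState.col]

/-- The state after the output has been fixed. -/
def NodeState.finish (n : NodeState) (y : NodeOutput) : NodeState := { n with out := some y }

/-- The residual list, when `k c` neighbors already have color `c`. -/
def NodeState.resList (n : NodeState) (k : ℕ → ℕ) : Finset ℕ :=
  n.inp.list.filter fun c => k c ≤ n.inp.defect c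

/-- The residual defects, when `k c` neighbors already have color `c`. -/
def NodeState.resDefect (n : NodeState) (k : ℕ → ℕ) (c : ℕ) : ℕ := n.inp.defect c - k c

/-- The node is uncolored and in class `i`, and its residual instance has slack `S` with respect to
its number `m` of uncolored neighbors in class `i`. -/
def NodeState.Ready (n : NodeState) (S : ℝ) (i : ℕ) (k : ℕ → ℕ) (m : ℕ) : Prop :=
  n.out = none ∧ n.cls = i ∧ S * m < ∑ c ∈ n.resList k, ((n.resDefect k c : ℝ) + 1)

section Subphase

variable {V : Type} {G : SimpleGraph V}

/-- The number of neighbors of `v` that already have color `c`. -/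
noncomputable def colorCount (G : SimpleGraph V) (s : V → NodeState) (v : V) (c : ℕ) : ℕ :=
  nbrCount G v fun u => (s u).col = some c

/-- The nodes of class `i` that get colored next. -/
def readySet (G : SimpleGraph V) (S : ℝ) (i : ℕ) (s : V → NodeState) : Set V :=
  {v | (s v).Ready S i (colorCount G s v)
    (nbrCount G v fun u => (s u).out = none ∧ (s u).cls = i)}

open Classical in
/-- The residual instance on the subgraph induced by the nodes that get colored next. -/
noncomputable def resInput (G : SimpleGraph V) (S : ℝ) (i : ℕ) (s : V → NodeState) (v : V) :
    Option NodeInput :=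
  if v ∈ readySet G S i s then
    some { ident := (s v).inp.ident
           degree := nbrCount G v fun u => u ∈ readySet G S i s
           color := (s v).inp.color
           list := (s v).resList (colorCount G s v)
           defect := (s v).resDefect (colorCount G s v) }
  else none

theorem isSome_resInput {S : ℝ} {i : ℕ} {s : V → NodeState} {v : V} :
    (resInput G S i s v).isSome ↔ v ∈ readySet G S i s := by
  unfold resInput
  split_ifs with h <;> simp [h]

open Classical in
/-- The ready nodes of class `i` color themselves by running `A` on their residual instance, and
orient their edges towards all previously colored neighbors. -/
noncomputable def colorClass (A : LocalAlgorithm NodeInput NodeOutput) (T : ℕ) (S : ℝ) (i : ℕ) :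
    NetMap NodeState NodeState := fun _ G p s v =>
  if h : (resInput G S i s v).isSome then
    (s v).finish
      { color := (A.output (A.state (p.induce {u | (resInput G S i s u).isSome})
          (fun w => (resInput G S i s w).get w.2) T ⟨v, h⟩)).color
        outPorts := {j | (∃ hj : j < nodeDegree G v, (s (p.nbr v ⟨j, hj⟩)).out ≠ none) ∨
          (j ∈ p.portsInto {u | (resInput G S i s u).isSome} v ∧
            (p.portsInto {u | (resInput G S i s u).isSome} v).idxOf j ∈
              (A.output (A.state (p.induce {u | (resInput G S i s u).isSome})
                (fun w => (resInput G S i s w).get w.2) T ⟨v, h⟩)).outPorts)} }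
  else s v

theorem RunsIn.resInput (S : ℝ) (i : ℕ) :
    RunsIn 2 (fun _ G _ s => _root_.resInput G S i s) := by
  classical
  -- After one round, a node knows its residual instance and whether it is ready.
  let ready : NodeState × ((NodeState → Bool) → ℕ) → Prop := fun a =>
    a.1.Ready S i (fun c => a.2 fun n => decide (n.col = some c))
      (a.2 fun n => decide (n.out = none ∧ n.cls = i))
  have h1 := (RunsIn.count NodeState).keep
  have h2 := h1.comp_keep ((RunsIn.count _).keep.map fun
    (a : (NodeState × (NodeState × ((NodeState → Bool) → ℕ))) × _) =>
    if ready a.1.2 then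
      some { ident := a.1.1.inp.ident
             degree := a.2 fun b => decide (ready b.2)
             color := a.1.1.inp.color
             list := a.1.1.resList fun c => a.1.2.2 fun n => decide (n.col = some c)
             defect := a.1.1.resDefect fun c => a.1.2.2 fun n => decide (n.col = some c) :
             NodeInput }
    else none)
  obtain ⟨B, hB⟩ := h2
  refine ⟨B, fun V G p s v => ?_⟩
  rw [hB]
  simp only [decide_eq_true_eq, ready]
  rfl

theorem RunsIn.colorClass (A : LocalAlgorithm NodeInput NodeOutput) (T : ℕ) (S : ℝ) (i : ℕ) :
    RunsIn (T + 3) (_root_.colorClass A T S i) := by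
  classical
  have h1 := ((RunsIn.ports fun n : NodeState => n.out ≠ none).comp (RunsIn.wait (T + 2))).pair
    (((RunsIn.resInput S i).comp (RunsIn.onActive A T)).comp (RunsIn.wait 0) |> fun h => by
      rwa [show 2 + (T + 1) + 0 = 1 + (T + 2) by omega] at h)
  have h2 := h1.keep.map fun a => match a.2.2 with
    | none => a.1
    | some y => a.1.finish
        { color := y.1.color
          outPorts := {j | j ∈ a.2.1 ∨ (j ∈ y.2 ∧ y.2.idxOf j ∈ y.1.outPorts)} }
  rw [show T + 3 = 1 + (T + 2) by omega]
  obtain ⟨B, hB⟩ := h2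
  refine ⟨B, fun V G p s v => ?_⟩
  rw [hB]
  by_cases h : (_root_.resInput G S i s v).isSome
  · simp only [_root_.colorClass, dif_pos h]
    rfl
  · simp only [_root_.colorClass, dif_neg h]

end Subphase

section Phase

variable {V : Type} {G : SimpleGraph V}

/-- The orientation of the edges that the colored nodes have fixed so far. -/
def outRel (p : PortNumbering G) (s : V → NodeState) (v u : V) : Prop :=
  ∃ h : G.Adj v u, ∃ y, (s v).out = some y ∧ p.portTo v u h ∈ y.outPorts

/-- The input of the nodes in an instance `(L, d)` with identifiers `ident` and proper coloring
`col`. -/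
noncomputable def instInput {N q : ℕ} (ident : V ↪ Fin N) (col : G.Coloring (Fin q))
    (L : V → Finset ℕ) (d : V → ℕ → ℕ) (v : V) : NodeInput :=
  { ident := (ident v : ℕ), degree := nodeDegree G v, color := (col v : ℕ),
    list := L v, defect := d v }

variable {A : LocalAlgorithm NodeInput NodeOutput} {T : ℕ} {S : ℝ} {i : ℕ}

theorem colorClass_of_notMem (p : PortNumbering G) {s : V → NodeState} {v : V}
    (h : v ∉ readySet G S i s) : colorClass A T S i p s v = s v :=
  dif_neg fun h' => h (isSome_resInput.mp h')

theorem colorClass_inp (p : PortNumbering G) (s : V → NodeState) (v : V) :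
    (colorClass A T S i p s v).inp = (s v).inp := by
  unfold colorClass
  split_ifs <;> rfl

theorem colorClass_cls (p : PortNumbering G) (s : V → NodeState) (v : V) :
    (colorClass A T S i p s v).cls = (s v).cls := by
  unfold colorClass
  split_ifs <;> rfl

theorem colorClass_out_eq_none (p : PortNumbering G) (s : V → NodeState) (v : V) :
    (colorClass A T S i p s v).out = none ↔ (s v).out = none ∧ v ∉ readySet G S i s := by
  by_cases h : v ∈ readySet G S i s
  · have : (colorClass A T S i p s v).out ≠ none := by
      unfold colorClass
      rw [dif_pos (isSome_resInput.mpr h)]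
      exact Option.some_ne_none _
    simp [this, h]
  · simp [colorClass_of_notMem p h, h]

theorem IsPartialColoring.colorClass {𝒢 : GraphClass} {Δ q N C : ℕ}
    (hA : A.SolvesPA T 𝒢 Δ q N S C) (hS : 0 ≤ S) [Finite V] (p : PortNumbering G)
    (ident : V ↪ Fin N) (col : G.Coloring (Fin q)) {L : V → Finset ℕ} {d : V → ℕ → ℕ}
    (hΔ : ∀ v, nodeDegree G v ≤ Δ) (hL : ∀ v, L v ⊆ Finset.range C) {s : V → NodeState}
    (hs : ∀ v, (s v).inp = instInput ident col L d v)
    (h𝒢 : 𝒢 _ (G.induce (readySet G S i s)))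
    (h : IsPartialColoring G L d (fun v => (s v).col) (outRel p s)) :
    IsPartialColoring G L d (fun v => (_root_.colorClass A T S i p s v).col)
      (outRel p (_root_.colorClass A T S i p s)) := by
  have hf := p.finite_neighborSet
  obtain ⟨W, hWdef⟩ : ∃ W : Set V, W = {u | (resInput G S i s u).isSome} := ⟨_, rfl⟩
  have hW : W = readySet G S i s := by
    rw [hWdef]
    ext v
    exact isSome_resInput
  rw [← hW] at h𝒢
  have hmem : ∀ v, v ∈ W ↔ (resInput G S i s v).isSome := fun v => by rw [hWdef]; rfl
  let L' : W → Finset ℕ := fun w => (s w).resList (colorCount G s w)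
  let d' : W → ℕ → ℕ := fun w => (s w).resDefect (colorCount G s w)
  let ident' : W ↪ Fin N := (Function.Embedding.subtype _).trans ident
  let col' : (G.induce W).Coloring (Fin q) := col.comp (SimpleGraph.Embedding.induce W).toHom
  have hres : ∀ w : W, resInput G S i s w = some (instInput ident' col' L' d' w) := by
    intro w
    unfold instInput
    unfold resInput
    rw [if_pos (hW ▸ w.2), hs w, nodeDegree_induce_eq, ← hW]
    rfl
  have hsol := hA W (G.induce W) h𝒢
    (fun w => by
      rw [nodeDegree_induce_eq]
      exact (nbrCount_le_degree (hf w) _).trans (hΔ w))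
    (p.induce W) ident' col' L' d'
    (fun w c hc => hL w (by
      have := (Finset.mem_filter.mp hc).1
      rwa [hs w] at this))
    (fun w => by
      have hw : (w : V) ∈ readySet G S i s := hW ▸ w.2
      refine lt_of_le_of_lt (mul_le_mul_of_nonneg_left ?_ hS) hw.2.2
      rw [nodeDegree_induce_eq]
      refine Nat.cast_le.mpr (nbrCount_mono (hf w) fun u _ hu => ?_)
      rw [hW] at hu
      exact ⟨hu.1, hu.2.1⟩)
  have hinp : instInput ident' col' L' d'
      = fun w : W => (resInput G S i s w).get ((hmem w).mp w.2) := by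
    funext w
    simp only [hres, Option.get_some]
  have hpos : ∀ w : W, _root_.colorClass A T S i p s w = (s w).finish
      { color := (A.output (A.state (p.induce W)
          (fun w => (resInput G S i s w).get ((hmem w).mp w.2)) T w)).color
        outPorts := {j | (∃ hj : j < nodeDegree G w, (s (p.nbr w ⟨j, hj⟩)).out ≠ none) ∨
          (j ∈ p.portsInto W w ∧ (p.portsInto W w).idxOf j ∈
              (A.output (A.state (p.induce W)
                (fun w => (resInput G S i s w).get ((hmem w).mp w.2)) T w)).outPorts)} } := by
    subst hWdef
    intro w
    exact dif_pos w.2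
  change IsListArbdefectiveColoring (G.induce W) L' d'
    (fun w => (A.output (A.state (p.induce W) (instInput ident' col' L' d') T w)).color)
    (fun w u => ∃ h : (G.induce W).Adj w u, (p.induce W).portTo w u h ∈
      (A.output (A.state (p.induce W) (instInput ident' col' L' d') T w)).outPorts) at hsol
  rw [hinp] at hsol
  refine h.extend hf (W := W) ?_ hsol ?_ ?_ ?_ ?_ ?_
  · intro v hv
    rw [hW] at hv
    exact NodeState.col_eq_none.mpr hv.1
  · intro w c hc
    obtain ⟨h1, h2⟩ := Finset.mem_filter.mp hc
    rw [hs w] at h1 h2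
    refine ⟨h1, ?_⟩
    simp only [d', NodeState.resDefect, hs w]
    exact (Nat.add_sub_cancel' h2).le
  · intro w
    simp only [hpos w]
    rfl
  · intro v hv
    rw [hW] at hv
    simp only [colorClass_of_notMem p hv]
  · intro w u hadj
    have hcol : ((s u).col ≠ none) ↔ (s u).out ≠ none := NodeState.col_eq_none.not
    rw [hcol]
    have h1 : outRel p (_root_.colorClass A T S i p s) w u ↔
        p.portTo w u hadj ∈ {j | (∃ hj : j < nodeDegree G w, (s (p.nbr w ⟨j, hj⟩)).out ≠ none) ∨
          (j ∈ p.portsInto W w ∧ (p.portsInto W w).idxOf j ∈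
              (A.output (A.state (p.induce W)
                (fun w => (resInput G S i s w).get ((hmem w).mp w.2)) T w)).outPorts)} := by
      unfold outRel
      rw [hpos w]
      constructor
      · rintro ⟨_, y, hy, hm⟩
        rw [← Option.some.inj hy] at hm
        exact hm
      · exact fun hm => ⟨hadj, _, rfl, hm⟩
    rw [h1, Set.mem_ofPred_eq]
    refine or_congr ?_ ?_
    · simp [p.nbr_portTo, p.portTo_lt]
    · rw [PortNumbering.mem_portsInto]
      simp only [p.nbr_portTo, p.portTo_lt, exists_true_left]
      constructor
      · rintro ⟨hu, hm⟩
        have hadj' : (G.induce W).Adj w ⟨u, hu⟩ := hadj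
        refine ⟨hu, hadj', ?_⟩
        rwa [p.portTo_induce W hadj']
      · rintro ⟨hu, h2, hm⟩
        rw [p.portTo_induce] at hm
        exact ⟨hu, hm⟩
  · intro v hv hne u hadj
    rw [hW] at hv
    simp only [outRel, colorClass_of_notMem p hv]

/-- The classes `0, …, m - 1` are processed one after the other. -/
noncomputable def colorClasses (A : LocalAlgorithm NodeInput NodeOutput) (T : ℕ) (S : ℝ) :
    ℕ → NetMap NodeState NodeState
  | 0 => fun _ _ _ s => s
  | m + 1 => fun _ _ p s => colorClass A T S m p (colorClasses A T S m p s)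

theorem RunsIn.colorClasses (A : LocalAlgorithm NodeInput NodeOutput) (T : ℕ) (S : ℝ) (m : ℕ) :
    RunsIn (m * (T + 3)) (_root_.colorClasses A T S m) := by
  induction m with
  | zero => rw [Nat.zero_mul]; exact RunsIn.pure id
  | succ m ih => rw [Nat.succ_mul]; exact ih.comp (RunsIn.colorClass A T S m)

theorem colorClasses_inp (p : PortNumbering G) (s : V → NodeState) (m : ℕ) (v : V) :
    (colorClasses A T S m p s v).inp = (s v).inp := by
  induction m with
  | zero => rfl
  | succ m ih => exact (colorClass_inp p _ v).trans ih

theorem colorClasses_cls (p : PortNumbering G) (s : V → NodeState) (m : ℕ) (v : V) :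
    (colorClasses A T S m p s v).cls = (s v).cls := by
  induction m with
  | zero => rfl
  | succ m ih => exact (colorClass_cls p _ v).trans ih

theorem colorClasses_out_eq_none (p : PortNumbering G) (s : V → NodeState) {m m' : ℕ}
    (hm : m ≤ m') (v : V) (h : (colorClasses A T S m' p s v).out = none) :
    (colorClasses A T S m p s v).out = none := by
  induction m', hm using Nat.le_induction with
  | base => exact h
  | succ m' _ ih => exact ih ((colorClass_out_eq_none p _ v).mp h).1

theorem IsPartialColoring.colorClasses {𝒢 : GraphClass} {Δ q N C : ℕ}
    (hA : A.SolvesPA T 𝒢 Δ q N S C) (hS : 0 ≤ S) [Finite V] (p : PortNumbering G)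
    (ident : V ↪ Fin N) (col : G.Coloring (Fin q)) {L : V → Finset ℕ} {d : V → ℕ → ℕ}
    (hΔ : ∀ v, nodeDegree G v ≤ Δ) (hL : ∀ v, L v ⊆ Finset.range C) {s : V → NodeState}
    (hs : ∀ v, (s v).inp = instInput ident col L d v)
    (h𝒢 : ∀ W : Set V, (∀ v ∈ W, ∀ u ∈ W, (s v).cls = (s u).cls) → 𝒢 _ (G.induce W))
    (h : IsPartialColoring G L d (fun v => (s v).col) (outRel p s)) (m : ℕ) :
    IsPartialColoring G L d (fun v => (_root_.colorClasses A T S m p s v).col)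
      (outRel p (_root_.colorClasses A T S m p s)) := by
  induction m with
  | zero => exact h
  | succ m ih =>
    refine ih.colorClass hA hS p ident col hΔ hL (fun v => ?_) (h𝒢 _ fun v hv u hu => ?_)
    · rw [colorClasses_inp, hs]
    · rw [← colorClasses_cls (A := A) (T := T) (S := S) p s m v,
        ← colorClasses_cls (A := A) (T := T) (S := S) p s m u]
      exact hv.2.1.trans hu.2.1.symm

/-- A node that stays uncolored was not ready when its class was processed, so its weight is at most
`S` times the number of initially uncolored neighbors in its class, plus one for each neighbor that
is colored in the end. -/
theorem weight_le_of_uncolored (p : PortNumbering G) {s : V → NodeState} (hS : 0 ≤ S) {m : ℕ}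
    {v : V} (hm : (s v).cls < m) (h : (colorClasses A T S m p s v).out = none) :
    ∑ c ∈ (s v).inp.list, (((s v).inp.defect c : ℝ) + 1)
      ≤ nbrCount G v (fun u => (colorClasses A T S m p s u).out ≠ none)
        + S * nbrCount G v (fun u => (s u).out = none ∧ (s u).cls = (s v).cls) := by
  have hf := p.finite_neighborSet v
  obtain ⟨i, hi⟩ : ∃ i, i = (s v).cls := ⟨_, rfl⟩
  rw [← hi] at hm ⊢
  obtain ⟨t, ht⟩ : ∃ t, t = colorClasses A T S i p s := ⟨_, rfl⟩
  have h1 := (colorClass_out_eq_none p _ v).mp (colorClasses_out_eq_none p s hm v h)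
  rw [← ht] at h1
  have hcls : (t v).cls = i := by rw [ht, colorClasses_cls, hi]
  have h2 : ∑ c ∈ (t v).resList (colorCount G t v),
      (((t v).resDefect (colorCount G t v) c : ℝ) + 1)
      ≤ S * nbrCount G v (fun u => (t u).out = none ∧ (t u).cls = i) := by
    by_contra hlt
    exact h1.2 ⟨h1.1, hcls, not_le.mp hlt⟩
  have h3 := sum_residual_ge hf (t v).inp.list (t v).inp.defect fun u => (t u).col
  have h4 : (nbrCount G v (fun u => (t u).out = none ∧ (t u).cls = i) : ℝ)
      ≤ nbrCount G v (fun u => (s u).out = none ∧ (s u).cls = i) := by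
    refine Nat.cast_le.mpr (nbrCount_mono hf fun u _ hu => ?_)
    rw [ht, colorClasses_cls] at hu
    exact ⟨colorClasses_out_eq_none p s (Nat.zero_le i) u hu.1, hu.2⟩
  have h5 : (nbrCount G v (fun u => (t u).col ≠ none) : ℝ)
      ≤ nbrCount G v (fun u => (colorClasses A T S m p s u).out ≠ none) := by
    refine Nat.cast_le.mpr (nbrCount_mono hf fun u _ hu hu' => ?_)
    rw [Ne, NodeState.col_eq_none, ht] at hu
    exact hu (colorClasses_out_eq_none p s hm.le u hu')
  have h6 : (t v).inp = (s v).inp := by rw [ht, colorClasses_inp]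
  rw [h6] at h3
  have h7 := mul_le_mul_of_nonneg_left h4 hS
  have h8 : ∑ c ∈ (t v).resList (colorCount G t v),
      (((t v).resDefect (colorCount G t v) c : ℝ) + 1) =
      ∑ c ∈ (s v).inp.list.filter
        (fun c => nbrCount G v (fun u => (t u).col = some c) ≤ (s v).inp.defect c),
          ((((s v).inp.defect c - nbrCount G v (fun u => (t u).col = some c) : ℕ) : ℝ) + 1) := by
    rw [NodeState.resList, h6]
    simp only [NodeState.resDefect, h6]
    rfl
  linarith

end Phase

/-! ### The iterated logarithm -/

/-- The iterated logarithm of a real number. -/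
noncomputable def realLogStar (x : ℝ) : ℕ := sInf {k : ℕ | (Real.logb 2)^[k] x ≤ 1}

theorem logStar_eq_realLogStar (n : ℕ) : logStar n = realLogStar n := rfl

theorem exists_iterate_logb_le_one (x : ℝ) : ∃ k : ℕ, (Real.logb 2)^[k] x ≤ 1 := by
  have key : ∀ n : ℕ, ∀ x : ℝ, x ≤ n → ∃ k : ℕ, (Real.logb 2)^[k] x ≤ 1 := by
    intro n
    induction n with
    | zero => exact fun x hx => ⟨0, by simp at hx ⊢; linarith⟩
    | succ n ih =>
      intro x hx
      by_cases h1 : x ≤ 1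
      · exact ⟨0, h1⟩
      · have h1' : 1 < x := not_le.mp h1
        have hlog : Real.logb 2 x ≤ n := by
          rw [Real.logb_le_iff_le_rpow one_lt_two (by linarith), Real.rpow_natCast]
          refine hx.trans ?_
          exact_mod_cast Nat.lt_two_pow_self (n := n)
        obtain ⟨k, hk⟩ := ih _ hlog
        exact ⟨k + 1, hk⟩
  obtain ⟨n, hn⟩ := exists_nat_ge x
  exact key n x hn

theorem iterate_realLogStar_le_one (x : ℝ) : (Real.logb 2)^[realLogStar x] x ≤ 1 :=
  Nat.sInf_mem (exists_iterate_logb_le_one x)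

theorem realLogStar_of_le_one {x : ℝ} (h : x ≤ 1) : realLogStar x = 0 :=
  Nat.sInf_eq_zero.mpr (Or.inl h)

theorem realLogStar_of_one_lt {x : ℝ} (h : 1 < x) :
    realLogStar x = realLogStar (Real.logb 2 x) + 1 := by
  refine le_antisymm (Nat.sInf_le ?_) ?_
  · exact iterate_realLogStar_le_one (Real.logb 2 x)
  · have h1 := iterate_realLogStar_le_one x
    cases hk : realLogStar x with
    | zero => rw [hk] at h1; exact absurd h1 (not_le.mpr h)
    | succ k =>
      rw [hk] at h1
      exact Nat.succ_le_succ (Nat.sInf_le h1)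

theorem realLogStar_mono {x y : ℝ} (h : x ≤ y) : realLogStar x ≤ realLogStar y := by
  induction hn : realLogStar y generalizing x y with
  | zero =>
    have h1 := iterate_realLogStar_le_one y
    rw [hn] at h1
    exact (realLogStar_of_le_one (h.trans h1)).le
  | succ n ih =>
    by_cases hx : x ≤ 1
    · simp [realLogStar_of_le_one hx]
    · have hx' := not_le.mp hx
      rw [realLogStar_of_one_lt (hx'.trans_le h)] at hn
      rw [realLogStar_of_one_lt hx']
      exact Nat.succ_le_succ (ih (Real.logb_le_logb_of_le one_lt_two (by linarith) h)
        (Nat.succ.inj hn))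

theorem logStar_mono {m n : ℕ} (h : m ≤ n) : logStar m ≤ logStar n :=
  realLogStar_mono (Nat.cast_le.mpr h)

theorem one_le_logStar {n : ℕ} (h : 2 ≤ n) : 1 ≤ logStar n := by
  rw [logStar_eq_realLogStar, realLogStar_of_one_lt (by exact_mod_cast h)]
  omega

theorem logStar_lt_of_le_logb {m n : ℕ} (hn : 1 < n) (h : (m : ℝ) ≤ Real.logb 2 n) :
    logStar m + 1 ≤ logStar n := by
  rw [logStar_eq_realLogStar, logStar_eq_realLogStar,
    realLogStar_of_one_lt (by exact_mod_cast hn : (1 : ℝ) < n)]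
  exact Nat.succ_le_succ (realLogStar_mono h)

/-- An affine change of the argument costs only an additive constant, since the logarithm maps
`D x + D` to a value of at most `D log x + D` when `D` is large enough. -/
theorem realLogStar_affine {D : ℝ} (hD : 1 + Real.logb 2 D ≤ D) (hD1 : 1 ≤ D) {x y : ℝ}
    (h : y ≤ D * x + D) : realLogStar y ≤ realLogStar (2 * D) + realLogStar x := by
  induction hn : realLogStar x generalizing x y with
  | zero =>
    have h1 := iterate_realLogStar_le_one x
    rw [hn] at h1
    have h1' : x ≤ 1 := h1
    exact realLogStar_mono (by nlinarith)
  | succ n ih =>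
    have hx : 1 < x := by
      by_contra hx
      rw [realLogStar_of_le_one (not_lt.mp hx)] at hn
      omega
    by_cases hy : y ≤ 1
    · simp [realLogStar_of_le_one hy]
    · have hy' := not_le.mp hy
      rw [realLogStar_of_one_lt hx] at hn
      rw [realLogStar_of_one_lt hy']
      have hlx : 0 ≤ Real.logb 2 x := Real.logb_nonneg one_lt_two hx.le
      have hle : Real.logb 2 y ≤ D * Real.logb 2 x + D := by
        have h1 : Real.logb 2 y ≤ Real.logb 2 (D * 2 * x) :=
          Real.logb_le_logb_of_le one_lt_two (by linarith) (by nlinarith)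
        rw [Real.logb_mul (by positivity) (by positivity), Real.logb_mul (by positivity)
          (by norm_num), Real.logb_self_eq_one one_lt_two] at h1
        nlinarith
      have := ih hle (Nat.succ.inj hn)
      omega

/-- Computing `log*` of a quantity of order `n²` instead of `n` costs a constant factor only. -/
theorem exists_logStar_mul_sq_le (K : ℕ) :
    ∃ r : ℕ, ∀ n : ℕ, 2 ≤ n → logStar (K * n ^ 2) ≤ r * logStar n := by
  obtain ⟨j, hj⟩ : ∃ j : ℕ, K ≤ 2 ^ j := ⟨K, Nat.lt_two_pow_self.le⟩
  have hD : 1 + Real.logb 2 ((2 : ℝ) ^ (j + 2)) ≤ (2 : ℝ) ^ (j + 2) := by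
    rw [← Real.rpow_natCast, Real.logb_rpow (by norm_num) (by norm_num), Real.rpow_natCast]
    exact_mod_cast (by rw [add_comm]; exact Nat.lt_two_pow_self : 1 + (j + 2) ≤ 2 ^ (j + 2))
  have hjD : (j : ℝ) ≤ (2 : ℝ) ^ (j + 2) := by
    exact_mod_cast (Nat.lt_two_pow_self.le.trans (Nat.pow_le_pow_right (by norm_num) (by omega)))
  have h2D : (2 : ℝ) ≤ (2 : ℝ) ^ (j + 2) := by
    exact_mod_cast (show 2 ^ 1 ≤ 2 ^ (j + 2) from Nat.pow_le_pow_right (by norm_num) (by omega))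
  refine ⟨realLogStar (2 * (2 : ℝ) ^ (j + 2)) + 1, fun n hn => ?_⟩
  have hn1 := one_le_logStar hn
  have hn' : (1 : ℝ) < n := by exact_mod_cast hn
  suffices h : logStar (K * n ^ 2) ≤ realLogStar (2 * (2 : ℝ) ^ (j + 2)) + logStar n by
    nlinarith
  rw [logStar_eq_realLogStar, logStar_eq_realLogStar]
  by_cases h1 : ((K * n ^ 2 : ℕ) : ℝ) ≤ 1
  · rw [realLogStar_of_le_one h1]
    exact Nat.zero_le _
  · rw [realLogStar_of_one_lt (not_le.mp h1), realLogStar_of_one_lt hn', ← add_assoc]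
    refine Nat.succ_le_succ (realLogStar_affine hD (by linarith) ?_)
    have hln : 0 ≤ Real.logb 2 n := Real.logb_nonneg one_lt_two hn'.le
    have h2 : Real.logb 2 ((K * n ^ 2 : ℕ) : ℝ) ≤ Real.logb 2 ((2 : ℝ) ^ j * (n : ℝ) ^ 2) := by
      refine Real.logb_le_logb_of_le one_lt_two (by linarith [not_le.mp h1]) ?_
      exact_mod_cast Nat.mul_le_mul_right _ hj
    rw [Real.logb_mul (by positivity) (by positivity), Real.logb_pow, Real.logb_pow,
      Real.logb_self_eq_one one_lt_two] at h2
    push_cast at h2 ⊢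
    nlinarith

/-! ### Defective color reduction -/

/-- In `T` rounds, an `m`-coloring can be turned into an `M`-coloring, such that the number of
neighbors of the same color grows by at most an `ε`-fraction of the degree. Only neighbors that
carry the flag `true` are counted. -/
def ReducesColors (m M T : ℕ) (ε : ℝ) : Prop :=
  ∃ F : NetMap (Bool × ℕ) ℕ, RunsIn T F ∧
    ∀ ⦃V : Type⦄ ⦃G : SimpleGraph V⦄ (p : PortNumbering G) (s : V → Bool × ℕ),
      (∀ v, (s v).2 < m) → ∀ v, F p s v < M ∧
        (nbrCount G v (fun u => (s u).1 = true ∧ F p s u = F p s v) : ℝ)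
          ≤ nbrCount G v (fun u => (s u).1 = true ∧ (s u).2 = (s v).2)
            + ε * nbrCount G v (fun u => (s u).1 = true)

namespace ReducesColors

theorem weaken {m M T : ℕ} {ε : ℝ} (h : ReducesColors m M T ε) {M' T' : ℕ} {ε' : ℝ}
    (hM : M ≤ M') (hT : T ≤ T') (hε : ε ≤ ε') : ReducesColors m M' T' ε' := by
  obtain ⟨F, hF, h⟩ := h
  refine ⟨F, ?_, fun V G p s hs v => ⟨(h p s hs v).1.trans_le hM, (h p s hs v).2.trans ?_⟩⟩
  · have := hF.comp (RunsIn.wait (T' - T))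
    rwa [Nat.add_sub_cancel' hT] at this
  · gcongr

theorem trans {m M M' T T' : ℕ} {ε ε' : ℝ} (h : ReducesColors m M T ε)
    (h' : ReducesColors M M' T' ε') : ReducesColors m M' (T + T') (ε + ε') := by
  obtain ⟨F, hF, h⟩ := h
  obtain ⟨F', hF', h'⟩ := h'
  refine ⟨_, ((hF.keep.map fun a => (a.1.1, a.2)).comp hF'), fun V G p s hs v => ?_⟩
  have h1 := h p s hs
  have h2 := h' p (fun v => ((s v).1, F p s v)) (fun v => (h1 v).1) v
  refine ⟨h2.1, h2.2.trans ?_⟩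
  rw [add_mul, ← add_assoc]
  exact add_le_add_left (h1 v).2 _

end ReducesColors

/-- Distinct polynomials of degree at most `k` over the field with `p` elements agree in at most `k`
points. -/
theorem exists_polynomial_family (p k m : ℕ) [Fact p.Prime] (hm : m ≤ p ^ (k + 1)) :
    ∃ f : ℕ → ZMod p → ZMod p, ∀ c < m, ∀ c' < m, c ≠ c' →
      (Finset.univ.filter fun x => f c x = f c' x).card ≤ k := by
  classical
  have hcard : Fintype.card (Fin m) ≤ Fintype.card (Fin (k + 1) → ZMod p) := by
    simpa [ZMod.card] using hm
  obtain ⟨g⟩ := Function.Embedding.nonempty_of_card_le hcard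
  let P : Fin m → Polynomial (ZMod p) := fun c =>
    ((Polynomial.degreeLTEquiv (ZMod p) (k + 1)).symm (g c) : Polynomial (ZMod p))
  have hP : Function.Injective P := fun c c' h => by
    have := Subtype.ext h
    exact g.injective ((Polynomial.degreeLTEquiv (ZMod p) (k + 1)).symm.injective this)
  have hdeg : ∀ c, P c ∈ Polynomial.degreeLT (ZMod p) (k + 1) := fun c => Subtype.property _
  refine ⟨fun c x => if h : c < m then (P ⟨c, h⟩).eval x else 0, fun c hc c' hc' hne => ?_⟩
  have hQ : P ⟨c, hc⟩ - P ⟨c', hc'⟩ ≠ 0 := by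
    rw [sub_ne_zero]
    exact fun h => hne (congrArg Fin.val (hP h))
  have hQdeg : (P ⟨c, hc⟩ - P ⟨c', hc'⟩).natDegree ≤ k := by
    have := Submodule.sub_mem _ (hdeg ⟨c, hc⟩) (hdeg ⟨c', hc'⟩)
    rw [Polynomial.mem_degreeLT, ← Polynomial.natDegree_lt_iff_degree_lt hQ] at this
    omega
  refine le_trans ?_ ((Polynomial.card_roots' _).trans hQdeg)
  refine le_trans (Finset.card_le_card (t := (P ⟨c, hc⟩ - P ⟨c', hc'⟩).roots.toFinset)
    fun x hx => ?_) (Multiset.toFinset_card_le _)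
  rw [Multiset.mem_toFinset, Polynomial.mem_roots hQ, Polynomial.IsRoot, Polynomial.eval_sub,
    sub_eq_zero]
  simpa [hc, hc'] using hx

theorem nbrCount_eq_card {V : Type} {G : SimpleGraph V} {v : V} (hf : (G.neighborSet v).Finite)
    (P : V → Prop) [DecidablePred P] : nbrCount G v P = (hf.toFinset.filter P).card := by
  rw [nbrCount, ← Set.ncard_coe_finset]
  congr 1
  ext u
  simp

/-- One round of color reduction. A node of color `c` looks for a point `x` in which its polynomial
agrees with few polynomials of other neighbors, and takes `x` with the value in `x` as its new
color. On average over `x`, each neighbor of a different color agrees with probability at most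
`k / p`. -/
theorem reducesColors_sq (p k m : ℕ) (hp : p.Prime) (hm : m ≤ p ^ (k + 1)) :
    ReducesColors m (p ^ 2) 1 ((k : ℝ) / p) := by
  classical
  have := Fact.mk hp
  obtain ⟨f, hf⟩ := exists_polynomial_family p k m hm
  let conf : ℕ → ZMod p → Bool × ℕ → Bool := fun c x n =>
    decide (n.1 = true ∧ n.2 ≠ c ∧ f n.2 x = f c x)
  have hex : ∀ (c : ℕ) (K : (Bool × ℕ → Bool) → ℕ), ∃ x, ∀ y, K (conf c x) ≤ K (conf c y) :=
    fun c K => Finite.exists_min fun x => K (conf c x)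
  choose pick hpick using hex
  refine ⟨_, (RunsIn.count (Bool × ℕ)).keep.map fun a =>
    (pick a.1.2 a.2).val * p + (f a.1.2 (pick a.1.2 a.2)).val, fun V G P s hs v => ?_⟩
  have hfin := P.finite_neighborSet v
  have hp0 : 0 < p := hp.pos
  set x : V → ZMod p := fun u => pick (s u).2 fun Q => nbrCount G u fun w => Q (s w) = true with hx
  change (x v).val * p + (f (s v).2 (x v)).val < p ^ 2 ∧ (nbrCount G v (fun u => (s u).1 = true ∧
    (x u).val * p + (f (s u).2 (x u)).val = (x v).val * p + (f (s v).2 (x v)).val) : ℝ) ≤ _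
  constructor
  · have h1 := ZMod.val_lt (x v)
    have h2 := ZMod.val_lt (f (s v).2 (x v))
    nlinarith
  · have hinj : ∀ u, (x u).val * p + (f (s u).2 (x u)).val
        = (x v).val * p + (f (s v).2 (x v)).val → f (s u).2 (x v) = f (s v).2 (x v) := by
      intro u hu
      have h1 := ZMod.val_lt (f (s u).2 (x u))
      have h2 := ZMod.val_lt (f (s v).2 (x v))
      have h3 := congrArg (· / p) hu
      have h4 := congrArg (· % p) hu
      simp only [Nat.mul_comm _ p, Nat.mul_add_div hp0, Nat.div_eq_of_lt h1, Nat.div_eq_of_lt h2,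
        Nat.mul_add_mod, Nat.mod_eq_of_lt h1, Nat.mod_eq_of_lt h2, Nat.add_zero] at h3 h4
      rw [← ZMod.val_injective p h3]
      exact ZMod.val_injective p (by rw [h4, ZMod.val_injective p h3])
    have h1 : nbrCount G v (fun u => (s u).1 = true ∧
        (x u).val * p + (f (s u).2 (x u)).val = (x v).val * p + (f (s v).2 (x v)).val)
        ≤ nbrCount G v (fun u => (s u).1 = true ∧ (s u).2 = (s v).2)
          + nbrCount G v (fun u => conf (s v).2 (x v) (s u) = true) := by
      refine (nbrCount_mono hfin fun u _ hu => ?_).trans (nbrCount_or_le _ _)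
      by_cases hc : (s u).2 = (s v).2
      · exact Or.inl ⟨hu.1, hc⟩
      · exact Or.inr (decide_eq_true ⟨hu.1, hc, hinj u hu.2⟩)
    have h2 : p * nbrCount G v (fun u => conf (s v).2 (x v) (s u) = true)
        ≤ k * nbrCount G v (fun u => (s u).1 = true) := by
      calc p * nbrCount G v (fun u => conf (s v).2 (x v) (s u) = true)
          = ∑ _y : ZMod p, nbrCount G v (fun u => conf (s v).2 (x v) (s u) = true) := by
            simp [ZMod.card]
        _ ≤ ∑ y : ZMod p, nbrCount G v (fun u => conf (s v).2 y (s u) = true) :=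
            Finset.sum_le_sum fun y _ => hpick (s v).2
              (fun Q => nbrCount G v fun w => Q (s w) = true) y
        _ = ∑ u ∈ hfin.toFinset.filter (fun u => (s u).1 = true),
              (Finset.univ.filter fun y => conf (s v).2 y (s u) = true).card := by
            simp only [nbrCount_eq_card hfin, Finset.card_filter]
            rw [Finset.sum_comm, Finset.sum_filter]
            refine Finset.sum_congr rfl fun u _ => ?_
            split_ifs with hu
            · rfl
            · exact Finset.sum_eq_zero fun y _ => by simp [conf, hu]
        _ ≤ ∑ u ∈ hfin.toFinset.filter (fun u => (s u).1 = true), k := by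
            refine Finset.sum_le_sum fun u _ => ?_
            by_cases hc : (s u).2 = (s v).2
            · simp [conf, hc]
            · refine le_trans (Finset.card_le_card fun y hy => ?_) (hf _ (hs u) _ (hs v) hc)
              simp only [Finset.mem_filter, conf, decide_eq_true_eq] at hy ⊢
              exact ⟨hy.1, hy.2.2.2⟩
        _ = k * nbrCount G v (fun u => (s u).1 = true) := by
            rw [nbrCount_eq_card hfin, Finset.sum_const, smul_eq_mul, mul_comm]
    have h3 : (nbrCount G v (fun u => conf (s v).2 (x v) (s u) = true) : ℝ)
        ≤ (k : ℝ) / p * nbrCount G v (fun u => (s u).1 = true) := by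
      rw [div_mul_eq_mul_div, le_div_iff₀ (by exact_mod_cast hp0), mul_comm]
      exact_mod_cast h2
    have h4 := (Nat.cast_le (α := ℝ)).mpr h1
    push_cast at h4
    linarith

theorem mul_add_le_two_pow {t : ℕ} (ht : 9 ≤ t) : 25 * t + 49 ≤ 2 ^ t := by
  induction t, ht using Nat.le_induction with
  | base => norm_num
  | succ t _ ih => rw [pow_succ]; omega

theorem clog_affine_le {β : ℕ} (hβ : 50 ≤ β) : 5 + 5 * Nat.clog 2 (4 + 5 * β) ≤ β := by
  have h1 : Nat.clog 2 (4 + 5 * β) ≤ (β - 5) / 5 := by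
    rw [Nat.clog_le_iff_le_pow one_lt_two]
    refine le_trans ?_ (mul_add_le_two_pow (t := (β - 5) / 5) (by omega))
    omega
  omega

theorem mul_add_le_two_pow_pred {β : ℕ} (hβ : 50 ≤ β) : 32 + 32 * β ≤ 2 ^ (β - 1) := by
  obtain ⟨t, rfl⟩ : ∃ t, β = t + 3 := ⟨β - 3, by omega⟩
  have := mul_add_le_two_pow (t := t) (by omega)
  rw [show t + 3 - 1 = t + 2 by omega, pow_add]
  omega

/-- A single step from few colors, `2 ^ b` with `b = O(log α)`, to `O(α²)` colors. -/
theorem reducesColors_few {c a α b m : ℕ} (hc : 2 ≤ c) (hα : 1 ≤ α) (ha : 2 ^ a ≤ 2 * α)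
    (hm : m ≤ 2 ^ b) (hb : b ≤ c * (a + 1)) :
    ReducesColors m (16 * c ^ 2 * α ^ 2) 1 (1 / (2 * α)) := by
  obtain ⟨p, hp, h1, h2⟩ := Nat.exists_prime_lt_and_le_two_mul (2 * c * α) (by positivity)
  have hp2 : 2 ^ (a + 1) ≤ p := by
    rw [pow_succ]
    nlinarith
  have hp0 : (0 : ℝ) < p := by exact_mod_cast hp.pos
  have hm' : m ≤ p ^ (c + 1) := by
    calc m ≤ 2 ^ (c * (a + 1)) := hm.trans (Nat.pow_le_pow_right (by norm_num) hb)
      _ = (2 ^ (a + 1)) ^ c := by rw [← pow_mul, mul_comm]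
      _ ≤ p ^ c := Nat.pow_le_pow_left hp2 c
      _ ≤ p ^ (c + 1) := Nat.pow_le_pow_right hp.pos (Nat.le_succ c)
  refine (reducesColors_sq p c m hp hm').weaken ?_ le_rfl ?_
  · calc p ^ 2 ≤ (2 * (2 * c * α)) ^ 2 := Nat.pow_le_pow_left h2 2
      _ = 16 * c ^ 2 * α ^ 2 := by ring
  · rw [div_le_div_iff₀ hp0 (by positivity)]
    have : ((2 * c * α : ℕ) : ℝ) ≤ p := by exact_mod_cast h1.le
    push_cast at this
    linarith

/-- A single step from `2 ^ b` colors to `2 ^ (O(log b) + O(log α))` colors. -/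
theorem reducesColors_many {a α b m : ℕ} (hα : 1 ≤ α) (ha : α ≤ 2 ^ a) (hb : 1 ≤ b)
    (hm : m ≤ 2 ^ b) :
    ReducesColors m (2 ^ (4 + 4 * Nat.clog 2 b + 2 * a)) 1 (1 / α * (1 / (2 * b))) := by
  obtain ⟨p, hp, h1, h2⟩ := Nat.exists_prime_lt_and_le_two_mul (2 * b ^ 2 * α) (by positivity)
  have hp0 : (0 : ℝ) < p := by exact_mod_cast hp.pos
  have hb0 : (0 : ℝ) < b := by exact_mod_cast hb
  have hα0 : (0 : ℝ) < α := by exact_mod_cast hα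
  have hm' : m ≤ p ^ (b + 1) :=
    hm.trans ((Nat.pow_le_pow_left hp.two_le b).trans (Nat.pow_le_pow_right hp.pos (Nat.le_succ b)))
  refine (reducesColors_sq p b m hp hm').weaken ?_ le_rfl ?_
  · calc p ^ 2 ≤ (2 * (2 * b ^ 2 * α)) ^ 2 := Nat.pow_le_pow_left h2 2
      _ ≤ (2 * (2 * (2 ^ Nat.clog 2 b) ^ 2 * 2 ^ a)) ^ 2 := by
        gcongr
        exact Nat.le_pow_clog one_lt_two b
      _ = 2 ^ (4 + 4 * Nat.clog 2 b + 2 * a) := by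
        rw [pow_add, pow_add, mul_comm 4, pow_mul, mul_comm 2 a, pow_mul]
        ring
  · rw [div_mul_div_comm, one_mul, div_le_div_iff₀ hp0 (by positivity)]
    have : ((2 * b ^ 2 * α : ℕ) : ℝ) ≤ p := by exact_mod_cast h1.le
    push_cast at this
    nlinarith

/-- The number of bits per color is at least halved by each step from more than `α ^ O(1)` colors,
so the defects `1 / (2 b α)` of the steps add up to at most `1 / α`; and two steps replace the number
`m` of colors by at most `log m`, unless `O(α²)` colors are reached. -/
theorem reducesColors_of_logStar_le {c a α : ℕ} (hc : 2 ^ 50 ≤ c) (hα : 1 ≤ α) (ha : α ≤ 2 ^ a)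
    (ha' : 2 ^ a ≤ 2 * α) (n : ℕ) : ∀ m b : ℕ, 1 ≤ b → m ≤ 2 ^ b → logStar m ≤ n →
    ReducesColors m (16 * c ^ 2 * α ^ 2) (2 * n + 1) (1 / α * (1 - 1 / (2 * b))) := by
  have hα0 : (0 : ℝ) < α := by exact_mod_cast hα
  have hc2 : 2 ≤ c := le_trans (by norm_num) hc
  have few : ∀ m b : ℕ, 1 ≤ b → m ≤ 2 ^ b → b ≤ c * (a + 1) →
      ReducesColors m (16 * c ^ 2 * α ^ 2) 1 (1 / α * (1 - 1 / (2 * b))) := by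
    intro m b hb hm hb'
    refine (reducesColors_few hc2 hα ha' hm hb').weaken le_rfl le_rfl ?_
    rw [one_div_mul_eq_div, div_le_div_iff₀ (by positivity) hα0]
    have hb1 : (1 : ℝ) ≤ b := by exact_mod_cast hb
    have : (1 : ℝ) / (2 * b) ≤ 1 / 2 := one_div_le_one_div_of_le (by norm_num) (by linarith)
    nlinarith
  have many : ∀ m b : ℕ, c * (a + 1) < b → m ≤ 2 ^ b → ∃ b', b' = 4 + 4 * Nat.clog 2 b + 2 * a ∧
      ReducesColors m (2 ^ b') 1 (1 / α * (1 - 1 / (2 * b)) - 1 / α * (1 - 1 / (2 * b'))) := by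
    intro m b hb hm
    refine ⟨_, rfl, ?_⟩
    have hcb : 2 ^ 50 < b := by nlinarith
    have hβ : 50 ≤ Nat.clog 2 b := by
      have := Nat.clog_mono_right 2 hcb.le
      rwa [Nat.clog_pow 2 50 one_lt_two] at this
    have h1 : 2 ^ (Nat.clog 2 b - 1) < b :=
      Nat.pow_pred_clog_lt_self one_lt_two (by omega)
    have h2 := mul_add_le_two_pow_pred hβ
    have h3 : 2 * (4 + 4 * Nat.clog 2 b + 2 * a) ≤ b := by
      have : 16 * (a + 1) ≤ c * (a + 1) := Nat.mul_le_mul_right _ (le_trans (by norm_num) hc)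
      omega
    refine (reducesColors_many hα ha (by omega) hm).weaken le_rfl le_rfl ?_
    rw [← mul_sub]
    refine mul_le_mul_of_nonneg_left ?_ (by positivity)
    have hb0 : (0 : ℝ) < b := by exact_mod_cast (by omega : 0 < b)
    have h5 : (1 : ℝ) / b ≤ 1 / (2 * (4 + 4 * Nat.clog 2 b + 2 * a : ℕ)) := by
      refine one_div_le_one_div_of_le (by positivity) ?_
      exact_mod_cast h3
    have h6 : (1 : ℝ) / (2 * b) = 1 / b / 2 := by rw [div_div, mul_comm]
    rw [h6]
    linarith
  induction n with
  | zero =>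
    intro m b hb hm hn
    have hm1 : m ≤ 2 ^ 1 := by
      by_contra h
      have := one_le_logStar (n := m) (by omega)
      omega
    refine (few m 1 le_rfl hm1 (by nlinarith)).weaken le_rfl le_rfl ?_
    refine mul_le_mul_of_nonneg_left ?_ (by positivity)
    refine sub_le_sub_left (one_div_le_one_div_of_le (by norm_num) ?_) _
    have : (1 : ℝ) ≤ b := by exact_mod_cast hb
    push_cast
    linarith
  | succ n ih =>
    intro m b hb hm hn
    -- It suffices to treat the least possible `b`.
    wlog hmb : b = 1 ∨ 2 ^ (b - 1) < m generalizing b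
    · push Not at hmb
      have hb1 : 1 ≤ b - 1 := by omega
      have hb0 : (1 : ℝ) ≤ (b - 1 : ℕ) := by exact_mod_cast hb1
      obtain ⟨b', hb', hm', hmb'⟩ : ∃ b', 1 ≤ b' ∧ m ≤ 2 ^ b' ∧ b' ≤ b ∧
          (b' = 1 ∨ 2 ^ (b' - 1) < m) := by
        by_cases hm2 : m ≤ 2
        · exact ⟨1, le_rfl, by simpa using hm2, hb, Or.inl rfl⟩
        · refine ⟨Nat.clog 2 m, Nat.clog_pos one_lt_two (by omega), Nat.le_pow_clog one_lt_two m,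
            (Nat.clog_le_iff_le_pow one_lt_two).mpr hm, Or.inr ?_⟩
          exact Nat.pow_pred_clog_lt_self one_lt_two (by omega)
      refine (this b' hb' hm' hmb'.2).weaken le_rfl le_rfl ?_
      refine mul_le_mul_of_nonneg_left ?_ (by positivity)
      have hb'' : (0 : ℝ) < b' := by exact_mod_cast hb'
      refine sub_le_sub_left (one_div_le_one_div_of_le (by positivity) ?_) _
      have : (b' : ℝ) ≤ b := by exact_mod_cast hmb'.1
      linarith
    by_cases h1 : b ≤ c * (a + 1)
    · exact (few m b hb hm h1).weaken le_rfl (by omega) le_rfl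
    push Not at h1
    have hcb : 2 ^ 50 < b := by nlinarith
    have hβ : 50 ≤ Nat.clog 2 b := by
      have := Nat.clog_mono_right 2 hcb.le
      rwa [Nat.clog_pow 2 50 one_lt_two] at this
    obtain ⟨b', hb', hr⟩ := many m b h1 hm
    by_cases h2 : b' ≤ c * (a + 1)
    · refine (hr.trans (few _ b' (by omega) le_rfl h2)).weaken le_rfl (by omega) ?_
      linarith
    push Not at h2
    obtain ⟨b'', hb'', hr'⟩ := many _ b' h2 le_rfl
    by_cases h3 : b'' ≤ c * (a + 1)
    · refine ((hr.trans hr').trans (few _ b'' (by omega) le_rfl h3)).weaken le_rfl (by omega) ?_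
      linarith
    push Not at h3
    -- As `b'` exceeds `c (a + 1)`, its term `2 a` is dominated by `clog b`; likewise in `b''`.
    have hca : 10 * (a + 1) ≤ c * (a + 1) := Nat.mul_le_mul_right _ (le_trans (by norm_num) hc)
    have h4 : b' ≤ 4 + 5 * Nat.clog 2 b := by omega
    have h5 : b'' ≤ 4 + 5 * Nat.clog 2 b' := by omega
    have h6 : b'' ≤ Nat.clog 2 b - 1 := by
      have h7 := Nat.clog_mono_right 2 h4
      have h8 := clog_affine_le hβ
      omega
    have h7 : 2 ^ b'' ≤ b - 1 := by
      have h8 : 2 ^ (Nat.clog 2 b - 1) < b :=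
        Nat.pow_pred_clog_lt_self one_lt_two (by omega)
      have h9 := Nat.pow_le_pow_right (n := 2) (by norm_num) h6
      omega
    have hm2 : 2 ^ (b - 1) < m := hmb.resolve_left (by omega)
    have hm1 : 1 < m := lt_of_le_of_lt Nat.one_le_two_pow hm2
    have h8 : logStar (2 ^ b'') + 1 ≤ logStar m := by
      refine logStar_lt_of_le_logb hm1 ?_
      have h9 : ((b - 1 : ℕ) : ℝ) ≤ Real.logb 2 m := by
        rw [Real.le_logb_iff_rpow_le one_lt_two (by exact_mod_cast (by omega : 0 < m)),
          Real.rpow_natCast]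
        exact_mod_cast hm2.le
      exact le_trans (by exact_mod_cast h7) h9
    refine ((hr.trans hr').trans (ih _ b'' (by omega) le_rfl (by omega))).weaken le_rfl
      (by omega) ?_
    linarith

/-- Defective coloring: `O(log* m)` rounds suffice to turn an `m`-coloring into an `O(α²)`-coloring
that has, at every node, at most a `1 / α`-fraction of additional monochromatic edges. -/
theorem exists_reducesColors : ∃ K : ℕ, 1 ≤ K ∧ ∀ α : ℕ, 1 ≤ α → ∀ m : ℕ,
    ReducesColors m (K * α ^ 2) (2 * logStar m + 1) (1 / α) := by
  -- For more than `c (log α + 1) ≥ 2 ^ 50` bits per color, the estimates on `clog` apply.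
  obtain ⟨c, hc⟩ : ∃ c : ℕ, 2 ^ 50 ≤ c := ⟨_, le_rfl⟩
  refine ⟨16 * c ^ 2, by nlinarith, fun α hα m => ?_⟩
  have hα0 : (0 : ℝ) < α := by exact_mod_cast hα
  have ha : 2 ^ Nat.clog 2 α ≤ 2 * α := by
    by_cases h : 1 < α
    · have := Nat.pow_pred_clog_lt_self one_lt_two h
      have h1 := Nat.clog_pos one_lt_two h
      obtain ⟨t, ht⟩ : ∃ t, Nat.clog 2 α = t + 1 := ⟨Nat.clog 2 α - 1, by omega⟩
      rw [ht] at this ⊢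
      rw [pow_succ]
      simp only [Nat.pred_succ] at this
      omega
    · obtain rfl : α = 1 := by omega
      simp
  refine (reducesColors_of_logStar_le hc hα (Nat.le_pow_clog one_lt_two α) ha (logStar m) m (m + 1)
    (by omega) (le_trans (Nat.le_succ m) Nat.lt_two_pow_self.le) le_rfl).weaken le_rfl le_rfl ?_
  refine mul_le_of_le_one_right (by positivity) ?_
  have : (0 : ℝ) ≤ 1 / (2 * (m + 1 : ℕ)) := by positivity
  linarith

/-! ### Upper bounds from algorithms -/

theorem TA_le_of_runsIn {𝒢 : GraphClass} {Δ q N C T : ℕ} {S : ℝ} {F : NetMap NodeInput NodeOutput}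
    (hF : RunsIn T F)
    (h : ∀ (V : Type) [Finite V] (G : SimpleGraph V), 𝒢 V G → (∀ v, nodeDegree G v ≤ Δ) →
      ∀ (p : PortNumbering G) (ident : V ↪ Fin N) (col : G.Coloring (Fin q))
        (L : V → Finset ℕ) (d : V → ℕ → ℕ), (∀ v, L v ⊆ Finset.range C) → HasSlack G L d S →
        IsListArbdefectiveColoring G L d (fun v => (F p (instInput ident col L d) v).color)
          (fun v u => ∃ h : G.Adj v u,
            p.portTo v u h ∈ (F p (instInput ident col L d) v).outPorts)) :
    TA 𝒢 Δ q N S C ≤ T := by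
  obtain ⟨A, hA⟩ := hF
  refine iInf₂_le T ⟨A, ?_⟩
  intro V _ G hG hΔ p ident col L d hL hS
  have := h V G hG hΔ p ident col L d hL hS
  simp only [← hA] at this
  exact this

theorem exists_solvesPA_of_TA_ne_top {𝒢 : GraphClass} {Δ q N C : ℕ} {S : ℝ}
    (h : TA 𝒢 Δ q N S C ≠ ⊤) :
    ∃ (T : ℕ) (A : LocalAlgorithm NodeInput NodeOutput),
      A.SolvesPA T 𝒢 Δ q N S C ∧ TA 𝒢 Δ q N S C = T := by
  classical
  have hex : ∃ T : ℕ, ∃ A : LocalAlgorithm NodeInput NodeOutput, A.SolvesPA T 𝒢 Δ q N S C := by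
    by_contra hne
    push Not at hne
    refine h ?_
    simp only [TA, iInf_eq_top]
    exact fun T ⟨A, hA⟩ => absurd hA (hne T A)
  obtain ⟨A, hA⟩ := Nat.find_spec hex
  refine ⟨Nat.find hex, A, hA, le_antisymm (iInf₂_le _ ⟨A, hA⟩) (le_iInf₂ fun T hT => ?_)⟩
  exact Nat.cast_le.mpr (Nat.find_min' hex hT)

theorem TA_mono_colors {𝒢 : GraphClass} {Δ q q' N C : ℕ} {S : ℝ} (hq : q ≤ q') :
    TA 𝒢 Δ q N S C ≤ TA 𝒢 Δ q' N S C := by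
  by_cases h : TA 𝒢 Δ q' N S C = ⊤
  · rw [h]
    exact le_top
  obtain ⟨T, A, hA, hT⟩ := exists_solvesPA_of_TA_ne_top h
  rw [hT]
  refine TA_le_of_runsIn (RunsIn.of_algorithm A T) fun V _ G hG hΔ p ident col L d hL hS => ?_
  exact hA V G hG hΔ p ident (SimpleGraph.Coloring.mk (fun v => Fin.castLE hq (col v))
    fun hadj h => col.valid hadj (Fin.castLE_injective hq h)) L d hL hS

theorem nbrCount_eq_zero {V : Type} {G : SimpleGraph V} {v : V} {P : V → Prop}
    (h : ∀ u, G.Adj v u → ¬ P u) : nbrCount G v P = 0 := by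
  have : {u | G.Adj v u ∧ P u} = ∅ := by
    ext u
    simpa using h u
  rw [nbrCount, this, Set.ncard_empty]

/-- A color reduction with defects below `1` can be applied to the initial coloring. -/
theorem TA_le_add_of_reducesColors {𝒢 : GraphClass} {Δ q M N C R : ℕ} {S : ℝ}
    (hR : ReducesColors q M R (1 / (Δ + 1 : ℕ))) :
    TA 𝒢 Δ q N S C ≤ TA 𝒢 Δ M N S C + R := by
  by_cases h : TA 𝒢 Δ M N S C = ⊤
  · rw [h, top_add]
    exact le_top
  obtain ⟨T, A, hA, hT⟩ := exists_solvesPA_of_TA_ne_top h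
  obtain ⟨F, hF, hF'⟩ := hR
  have h1 := (((RunsIn.pure fun n : NodeInput => (true, n.color)).comp hF).keep.map
    fun a => { a.1 with color := a.2 }).comp (RunsIn.of_algorithm A T)
  rw [hT, add_comm, ← Nat.cast_add]
  rw [Nat.zero_add] at h1
  refine TA_le_of_runsIn h1 fun V _ G hG hΔ p ident col L d hL hS => ?_
  have h2 := hF' p (fun v => (true, (col v : ℕ))) (fun v => (col v).2)
  have h3 : ∀ v u, G.Adj v u →
      F p (fun v => (true, (col v : ℕ))) v ≠ F p (fun v => (true, (col v : ℕ))) u := by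
    intro v u hadj heq
    have h4 := (h2 v).2
    rw [nbrCount_eq_zero (P := fun u => _ ∧ (col u : ℕ) = _)
      fun u hadj hu => col.valid hadj (Fin.ext hu.2.symm)] at h4
    have h5 : 1 ≤ nbrCount G v (fun u => true = true ∧
        F p (fun v => (true, (col v : ℕ))) u = F p (fun v => (true, (col v : ℕ))) v) :=
      (Set.ncard_pos ((p.finite_neighborSet v).subset fun _ hu => hu.1)).mpr
        ⟨u, hadj, rfl, heq.symm⟩
    have h6 : nbrCount G v (fun _ => true = true) ≤ Δ :=
      (nbrCount_le_degree (p.finite_neighborSet v) _).trans (hΔ v)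
    have h7 : (1 : ℝ) / (Δ + 1 : ℕ) * nbrCount G v (fun _ => true = true) < 1 := by
      rw [one_div_mul_eq_div, div_lt_one (by positivity)]
      exact_mod_cast Nat.lt_succ_of_le h6
    have h8 : (1 : ℝ) ≤ nbrCount G v (fun u => true = true ∧
        F p (fun v => (true, (col v : ℕ))) u = F p (fun v => (true, (col v : ℕ))) v) := by
      exact_mod_cast h5
    rw [Nat.cast_zero, zero_add] at h4
    exact absurd (h8.trans h4) (not_le.mpr h7)
  exact hA V G hG hΔ p ident (SimpleGraph.Coloring.mk
    (fun v => ⟨F p (fun v => (true, (col v : ℕ))) v, (h2 v).1⟩)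
    fun hadj h => h3 _ _ hadj (congrArg Fin.val h)) L d hL hS

/-! ### Phases -/

section Phases

variable {V : Type} {G : SimpleGraph V}

/-- The state `s` arises from the instance `(L, d)` by fixing the outputs of some nodes, such
that these form a partial solution. -/
structure IsConsistent (p : PortNumbering G) {N q : ℕ} (ident : V ↪ Fin N)
    (col : G.Coloring (Fin q)) (L : V → Finset ℕ) (d : V → ℕ → ℕ) (s : V → NodeState) : Prop where
  inp : ∀ v, (s v).inp = instInput ident col L d v
  partialColoring : IsPartialColoring G L d (fun v => (s v).col) (outRel p s)

/-- The state before any output has been fixed. -/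
def initState (n : NodeInput) : NodeState := { inp := n, out := none, cls := 0 }

theorem isConsistent_initState (p : PortNumbering G) {N q : ℕ} (ident : V ↪ Fin N)
    (col : G.Coloring (Fin q)) (L : V → Finset ℕ) (d : V → ℕ → ℕ) :
    IsConsistent p ident col L d fun v => initState (instInput ident col L d v) := by
  refine ⟨fun _ => rfl, ?_, ?_, ?_, ?_⟩
  · exact fun v c h => absurd h (by simp [NodeState.col, initState])
  · exact fun v u c _ h => absurd h (by simp [NodeState.col, initState])
  · exact fun v u _ h => absurd rfl h
  · exact fun v c h => absurd h (by simp [NodeState.col, initState])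

theorem IsConsistent.isListArbdefectiveColoring {p : PortNumbering G} {N q : ℕ}
    {ident : V ↪ Fin N} {col : G.Coloring (Fin q)} {L : V → Finset ℕ} {d : V → ℕ → ℕ}
    {s : V → NodeState} (h : IsConsistent p ident col L d s) (hs : ∀ v, (s v).out ≠ none) :
    IsListArbdefectiveColoring G L d (fun v => ((s v).out.getD ⟨0, ∅⟩).color)
      (fun v u => ∃ h : G.Adj v u, p.portTo v u h ∈ ((s v).out.getD ⟨0, ∅⟩).outPorts) := by
  have h1 := h.partialColoring
  choose y hy using fun v => Option.ne_none_iff_exists'.mp (hs v)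
  have h2 : (fun v => (s v).col) = fun v => some ((s v).out.getD ⟨0, ∅⟩).color := by
    funext v
    simp [NodeState.col, hy]
  have h3 : outRel p s = fun v u => ∃ h : G.Adj v u,
      p.portTo v u h ∈ ((s v).out.getD ⟨0, ∅⟩).outPorts := by
    funext v u
    simp [outRel, hy]
  rw [h2, h3] at h1
  exact h1.isListArbdefectiveColoring

theorem TA_le_of_phases {𝒢 : GraphClass} {Δ q N C T : ℕ} {S : ℝ} {Φ : NetMap NodeState NodeState}
    (hΦ : RunsIn T Φ)
    (h : ∀ (V : Type) [Finite V] (G : SimpleGraph V), 𝒢 V G → (∀ v, nodeDegree G v ≤ Δ) →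
      ∀ (p : PortNumbering G) (ident : V ↪ Fin N) (col : G.Coloring (Fin q))
        (L : V → Finset ℕ) (d : V → ℕ → ℕ), (∀ v, L v ⊆ Finset.range C) → HasSlack G L d S →
        IsConsistent p ident col L d (Φ p fun v => initState (instInput ident col L d v)) ∧
          ∀ v, (Φ p (fun v => initState (instInput ident col L d v)) v).out ≠ none) :
    TA 𝒢 Δ q N S C ≤ T := by
  -- The default output is never used, since every node is colored in the end.
  have h1 := ((RunsIn.pure initState).comp hΦ).map fun n => n.out.getD ⟨0, ∅⟩
  rw [Nat.zero_add] at h1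
  refine TA_le_of_runsIn h1 fun V _ G hG hΔ p ident col L d hL hS => ?_
  have h2 := h V G hG hΔ p ident col L d hL hS
  exact h2.1.isListArbdefectiveColoring h2.2

/-- One phase: the nodes compute their classes by `R`, and all classes are processed by `A`. -/
noncomputable def phase (R : NetMap NodeState ℕ) (M : ℕ) (A : LocalAlgorithm NodeInput NodeOutput)
    (T : ℕ) (S : ℝ) : NetMap NodeState NodeState := fun _ _ p s =>
  colorClasses A T S M p fun v => { s v with cls := R p s v }

theorem RunsIn.phase {R : NetMap NodeState ℕ} {TR : ℕ} (hR : RunsIn TR R) (M : ℕ)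
    (A : LocalAlgorithm NodeInput NodeOutput) (T : ℕ) (S : ℝ) :
    RunsIn (TR + M * (T + 3)) (_root_.phase R M A T S) :=
  (hR.keep.map fun a => ({ a.1 with cls := a.2 } : NodeState)).comp (RunsIn.colorClasses A T S M)

variable {R : NetMap NodeState ℕ} {M T : ℕ} {A : LocalAlgorithm NodeInput NodeOutput} {S : ℝ}

theorem phase_out_eq_none {p : PortNumbering G} {s : V → NodeState} {v : V}
    (h : (phase R M A T S p s v).out = none) : (s v).out = none :=
  colorClasses_out_eq_none p (fun v => { s v with cls := R p s v }) (Nat.zero_le M) v h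

theorem IsConsistent.phase {𝒢 : GraphClass} {Δ q N C : ℕ}
    (hA : A.SolvesPA T 𝒢 Δ q N S C) (hS : 0 ≤ S) [Finite V] {p : PortNumbering G}
    {ident : V ↪ Fin N} {col : G.Coloring (Fin q)} {L : V → Finset ℕ} {d : V → ℕ → ℕ}
    (hΔ : ∀ v, nodeDegree G v ≤ Δ) (hL : ∀ v, L v ⊆ Finset.range C) {s : V → NodeState}
    (h𝒢 : ∀ W : Set V, (∀ v ∈ W, ∀ u ∈ W, R p s v = R p s u) → 𝒢 _ (G.induce W))
    (h : IsConsistent p ident col L d s) :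
    IsConsistent p ident col L d (_root_.phase R M A T S p s) :=
  ⟨fun v => (colorClasses_inp p _ M v).trans (h.inp v),
    IsPartialColoring.colorClasses (s := fun v => { s v with cls := R p s v }) hA hS p ident col
      hΔ hL h.inp h𝒢 h.partialColoring M⟩

theorem IsConsistent.weight_le_of_phase {q N : ℕ} {p : PortNumbering G}
    {ident : V ↪ Fin N} {col : G.Coloring (Fin q)} {L : V → Finset ℕ} {d : V → ℕ → ℕ}
    {s : V → NodeState} (h : IsConsistent p ident col L d s) (hS : 0 ≤ S)
    {v : V} (hR : R p s v < M) (hv : (_root_.phase R M A T S p s v).out = none) :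
    ∑ c ∈ L v, ((d v c : ℝ) + 1)
      ≤ nbrCount G v (fun u => (_root_.phase R M A T S p s u).out ≠ none)
        + S * nbrCount G v (fun u => (s u).out = none ∧ R p s u = R p s v) := by
  have := weight_le_of_uncolored p (s := fun v => { s v with cls := R p s v }) hS hR hv
  simp only [h.inp v] at this
  exact this

end Phases

/-- The classes of a phase are a defective coloring of the graph of the uncolored nodes. -/
theorem exists_defective_classes {q M TR : ℕ} {ε : ℝ} (hR : ReducesColors q M TR ε) :
    ∃ R : NetMap NodeState ℕ, RunsIn TR R ∧ ∀ ⦃V : Type⦄ ⦃G : SimpleGraph V⦄ (p : PortNumbering G)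
      (N : ℕ) (ident : V ↪ Fin N) (col : G.Coloring (Fin q)) (L : V → Finset ℕ) (d : V → ℕ → ℕ)
      (s : V → NodeState), IsConsistent p ident col L d s → ∀ v, R p s v < M ∧
        (nbrCount G v (fun u => (s u).out = none ∧ R p s u = R p s v) : ℝ)
          ≤ ε * nbrCount G v (fun u => (s u).out = none) := by
  obtain ⟨F, hF, hF'⟩ := hR
  refine ⟨_, ((RunsIn.pure fun n : NodeState => (n.out.isNone, n.inp.color)).comp hF |> fun h => by
    rwa [Nat.zero_add] at h), fun V G p N ident col L d s hs v => ?_⟩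
  have h1 := hF' p (fun v => ((s v).out.isNone, (s v).inp.color))
    (fun v => by rw [hs.inp v]; exact (col v).2) v
  refine ⟨h1.1, ?_⟩
  have h2 := h1.2
  have h3 : nbrCount G v (fun u => (s u).out.isNone = true ∧ (s u).inp.color = (s v).inp.color)
      = 0 := by
    refine nbrCount_eq_zero fun u hadj hu => ?_
    rw [hs.inp u, hs.inp v] at hu
    exact col.valid hadj (Fin.ext hu.2.symm)
  dsimp only at h2
  rw [h3, Nat.cast_zero, zero_add] at h2
  simp only [Option.isNone_iff_eq_none] at h2
  exact h2

/-! ### Trivial and greedy algorithms -/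

open Classical in
/-- The algorithm that outputs an arbitrary color of the list and orients no edge outwards. -/
noncomputable def anyColor : LocalAlgorithm NodeInput NodeOutput where
  State := NodeInput
  Msg := Unit
  init := id
  send := fun _ _ => ()
  step := fun s _ => s
  output := fun s => ⟨if h : s.list.Nonempty then h.choose else 0, ∅⟩

theorem nodeDegree_eq_zero {V : Type} {G : SimpleGraph V} (hG : ∀ u v, ¬ G.Adj u v) (v : V) :
    nodeDegree G v = 0 := by
  have : G.neighborSet v = ∅ := by
    ext u
    simpa using hG v u
  rw [nodeDegree, this, Set.ncard_empty]

theorem list_nonempty_of_hasSlack {V : Type} {G : SimpleGraph V} {L : V → Finset ℕ}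
    {d : V → ℕ → ℕ} {S : ℝ} (hS : HasSlack G L d S) {v : V} (hv : 0 ≤ S * nodeDegree G v) :
    (L v).Nonempty := by
  rw [Finset.nonempty_iff_ne_empty]
  intro hL
  have := hS v
  rw [hL, Finset.sum_empty] at this
  linarith

theorem anyColor_solvesPA {𝒢 : GraphClass} {Δ q N C : ℕ} {S : ℝ}
    (h : ∀ (V : Type) [Finite V] (G : SimpleGraph V), 𝒢 V G → (∀ v, nodeDegree G v ≤ Δ) →
      (V ↪ Fin N) → G.Coloring (Fin q) → ∀ (L : V → Finset ℕ) (d : V → ℕ → ℕ),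
      (∀ v, L v ⊆ Finset.range C) → HasSlack G L d S → ∀ u v, ¬ G.Adj u v) :
    anyColor.SolvesPA 0 𝒢 Δ q N S C := by
  intro V _ G hG hΔ p ident col L d hL hS
  have hadj := h V G hG hΔ ident col L d hL hS
  refine ⟨fun v => ?_, fun v u hvu => absurd hvu (hadj v u), fun v => ?_⟩
  · have hne : (L v).Nonempty :=
      list_nonempty_of_hasSlack hS (by rw [nodeDegree_eq_zero hadj v]; simp)
    change (if h : (L v).Nonempty then h.choose else 0) ∈ L v
    rw [dif_pos hne]
    exact hne.choose_spec
  · exact (nbrCount_eq_zero fun u hu => absurd hu (hadj v u)).le.trans (Nat.zero_le _)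

theorem TA_eq_zero {𝒢 : GraphClass} {Δ q N C : ℕ} {S : ℝ}
    (h : ∀ (V : Type) [Finite V] (G : SimpleGraph V), 𝒢 V G → (∀ v, nodeDegree G v ≤ Δ) →
      (V ↪ Fin N) → G.Coloring (Fin q) → ∀ (L : V → Finset ℕ) (d : V → ℕ → ℕ),
      (∀ v, L v ⊆ Finset.range C) → HasSlack G L d S → ∀ u v, ¬ G.Adj u v) :
    TA 𝒢 Δ q N S C = 0 :=
  le_antisymm (iInf₂_le_of_le 0 ⟨anyColor, anyColor_solvesPA h⟩ (by simp)) bot_le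

theorem TA_eq_zero_of_color_le_one {𝒢 : GraphClass} {Δ q N C : ℕ} {S : ℝ} (hq : q ≤ 1) :
    TA 𝒢 Δ q N S C = 0 := by
  refine TA_eq_zero fun V _ G _ _ _ col L d _ _ u v h => col.valid h (Fin.ext ?_)
  have h1 := (col u).2
  have h2 := (col v).2
  omega

theorem TA_eq_zero_of_degree_zero {𝒢 : GraphClass} {q N C : ℕ} {S : ℝ} :
    TA 𝒢 0 q N S C = 0 := by
  refine TA_eq_zero fun V _ G _ hΔ _ _ L d _ _ u v h => ?_
  have h1 : 0 < nodeDegree G u := (Set.ncard_pos (Set.toFinite _)).mpr ⟨v, h⟩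
  have h2 := hΔ u
  omega

/-- The color classes of a proper `m`-coloring can be processed one after the other. -/
theorem TA_le_greedy {𝒢 : GraphClass} {Δ q N C m : ℕ} {S : ℝ} (hS : 1 ≤ S) (f : NodeInput → ℕ)
    (hf : ∀ (V : Type) (G : SimpleGraph V) (ident : V ↪ Fin N) (col : G.Coloring (Fin q))
      (L : V → Finset ℕ) (d : V → ℕ → ℕ), (∀ v, f (instInput ident col L d v) < m) ∧
        ∀ u v, G.Adj u v → f (instInput ident col L d u) ≠ f (instInput ident col L d v)) :
    TA 𝒢 Δ q N S C ≤ (3 * m : ℕ) := by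
  have hA : anyColor.SolvesPA 0 (fun _ G => ∀ u v, ¬ G.Adj u v) Δ q N 1 C :=
    anyColor_solvesPA fun _ _ _ h _ _ _ _ _ _ _ => h
  have hΦ := (RunsIn.pure fun n : NodeState => f n.inp).phase m anyColor 0 1
  rw [show 0 + m * (0 + 3) = 3 * m by ring] at hΦ
  refine TA_le_of_phases hΦ fun V _ G hG hΔ p ident col L d hL hslack => ?_
  obtain ⟨hf1, hf2⟩ := hf V G ident col L d
  have hinit := isConsistent_initState p ident col L d
  refine ⟨hinit.phase hA zero_le_one hΔ hL fun W hW u v huv => ?_, fun v hv => ?_⟩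
  · exact hf2 u v huv (hW u u.2 v v.2)
  · have h1 := hinit.weight_le_of_phase zero_le_one (hf1 v) hv
    have h2 := hslack v
    rw [nbrCount_eq_zero (P := fun u => (initState (instInput ident col L d u)).out = none ∧ _)
      fun u hu h => hf2 v u hu h.2.symm, Nat.cast_zero, mul_zero, add_zero] at h1
    have h3 := h1.trans (Nat.cast_le.mpr (nbrCount_le_degree (p.finite_neighborSet v) _))
    have h4 : (0 : ℝ) ≤ nodeDegree G v := Nat.cast_nonneg _
    nlinarith

theorem TA_le_three_mul_colors {𝒢 : GraphClass} {Δ q N C : ℕ} {S : ℝ} (hS : 1 ≤ S) :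
    TA 𝒢 Δ q N S C ≤ (3 * q : ℕ) :=
  TA_le_greedy hS NodeInput.color fun _ _ _ col _ _ =>
    ⟨fun v => (col v).2, fun _ _ h h' => col.valid h (Fin.ext h')⟩

theorem TA_le_three_mul_idents {𝒢 : GraphClass} {Δ q N C : ℕ} {S : ℝ} (hS : 1 ≤ S) :
    TA 𝒢 Δ q N S C ≤ (3 * N : ℕ) :=
  TA_le_greedy hS NodeInput.ident fun _ _ ident _ _ _ =>
    ⟨fun v => (ident v).2, fun _ _ h h' => h.ne (ident.injective (Fin.ext h'))⟩

/-! ### No algorithm is correct without communication -/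

/-- Without communication, the orientation of a single edge is decided by the identifiers and colors
of its endpoints alone. Among three nodes with different identifiers and colors, two would decide in
the same way. -/
theorem not_solvesPA_zero {𝒢 : GraphClass} (h𝒢 : 𝒢.Hereditary) {Δ q N C : ℕ} {S : ℝ}
    (hΔ : 1 ≤ Δ) (hq : 3 ≤ q) (hN : 3 ≤ N) (hC : 1 ≤ C) {V₀ : Type} {G₀ : SimpleGraph V₀}
    (hG₀ : 𝒢 V₀ G₀) {a b : V₀} (hab : G₀.Adj a b) (A : LocalAlgorithm NodeInput NodeOutput) :
    ¬ A.SolvesPA 0 𝒢 Δ q N S C := by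
  intro hA
  let G : SimpleGraph Bool := ⊤
  have hG : 𝒢 Bool G := by
    refine h𝒢 V₀ Bool G₀ G ⟨⟨⟨fun x => if x then a else b, ?_⟩, ?_⟩⟩ hG₀
    · intro x y
      cases x <;> cases y <;> simp [hab.ne, hab.ne.symm]
    · intro x y
      cases x <;> cases y <;> simp [G] <;> first | exact hab | exact hab.symm
  have hdeg : ∀ v, nodeDegree G v = 1 := by
    intro v
    have : G.neighborSet v = {!v} := by
      ext u
      cases u <;> cases v <;> simp [G]
    rw [nodeDegree, this, Set.ncard_singleton]
  let p : PortNumbering G := fun v => (Finite.equivFin (G.neighborSet v)).symm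
  -- The decision of a node to orient its only edge outwards depends on its identifier and color.
  let x : Fin 3 → NodeInput := fun i =>
    { ident := i, degree := 1, color := i, list := {0}, defect := fun _ => ⌈S⌉₊ }
  let B : Fin 3 → Prop := fun i => 0 ∈ (A.output (A.init (x i))).outPorts
  have key : ∀ i j : Fin 3, i ≠ j → (B i ↔ ¬ B j) := by
    intro i j hij
    let g : Bool → Fin 3 := fun x => if x then i else j
    have hg : Function.Injective g := by
      intro x y
      cases x <;> cases y <;> simp [g, hij, hij.symm]
    let ident : Bool ↪ Fin N := ⟨fun x => Fin.castLE hN (g x), (Fin.castLE_injective hN).comp hg⟩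
    let col : G.Coloring (Fin q) := SimpleGraph.Coloring.mk (fun x => Fin.castLE hq (g x))
        fun hadj h => hadj.ne (hg (Fin.castLE_injective hq h))
    have hsol := hA Bool G hG (fun v => (hdeg v).le.trans hΔ) p ident col
      (fun _ => {0}) (fun _ _ => ⌈S⌉₊)
      (fun _ => Finset.singleton_subset_iff.mpr (Finset.mem_range.mpr hC)) (fun v => by
        rw [hdeg, Finset.sum_singleton, Nat.cast_one, mul_one]
        exact lt_of_le_of_lt (Nat.le_ceil S) (lt_add_one _))
    have hinp : instInput ident col (fun _ => {0}) (fun _ _ => ⌈S⌉₊) = fun v => x (g v) := by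
      funext v
      simp only [instInput, hdeg]
      rfl
    change IsListArbdefectiveColoring G _ _
      (fun v => (A.output (A.init (instInput ident col (fun _ => {0}) (fun _ _ => ⌈S⌉₊) v))).color)
      (fun v u => ∃ h : G.Adj v u, p.portTo v u h ∈
        (A.output (A.init (instInput ident col (fun _ => {0}) (fun _ _ => ⌈S⌉₊) v))).outPorts)
      at hsol
    rw [hinp] at hsol
    have e1 : G.Adj true false := by simp [G]
    have h1 := hsol.2.1 true false e1
      ((Finset.mem_singleton.mp (hsol.1 true)).trans (Finset.mem_singleton.mp (hsol.1 false)).symm)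
    have hport : ∀ (v u : Bool) (h : G.Adj v u), p.portTo v u h = 0 := by
      intro v u h
      have := p.portTo_lt h
      rw [hdeg] at this
      omega
    simp only [hport] at h1
    have h2 : B (g true) ↔ ¬ B (g false) :=
      ⟨fun h h' => h1.mp ⟨e1, h⟩ ⟨e1.symm, h'⟩, fun h => (h1.mpr fun ⟨_, h'⟩ => h h').2⟩
    exact h2
  have h01 := key 0 1 (by decide)
  have h02 := key 0 2 (by decide)
  have h12 := key 1 2 (by decide)
  tauto

/-! ### The two reductions -/

/-- Increasing the slack from `2` to `S ≤ α`: a defective coloring with defects `deg / α` splits the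
nodes into `O(α²)` classes, in each of which every node has slack `S`. -/
theorem TA_two_le {𝒢 : GraphClass} (h𝒢 : 𝒢.Hereditary) {Δ q N C M R T α : ℕ} {S : ℝ}
    (hS : 0 ≤ S) (hα : S ≤ α) (hα0 : 1 ≤ α) (hR : ReducesColors q M R (1 / α))
    {A : LocalAlgorithm NodeInput NodeOutput} (hA : A.SolvesPA T 𝒢 Δ q N S C) :
    TA 𝒢 Δ q N 2 C ≤ (R + M * (T + 3) : ℕ) := by
  obtain ⟨F, hF, hF'⟩ := exists_defective_classes hR
  refine TA_le_of_phases (hF.phase M A T S) fun V _ G hG hΔ p ident col L d hL hslack => ?_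
  have hinit := isConsistent_initState p ident col L d
  have hdef := hF' p N ident col L d _ hinit
  refine ⟨hinit.phase hA hS hΔ hL fun W _ => h𝒢 V W G _ ⟨SimpleGraph.Embedding.induce W⟩ hG,
    fun v hv => ?_⟩
  have h1 := hinit.weight_le_of_phase hS (hdef v).1 hv
  have h2 := hslack v
  have h3 : (nbrCount G v (fun u => (phase F M A T S p
      (fun v => initState (instInput ident col L d v)) u).out ≠ none) : ℝ) ≤ nodeDegree G v :=
    Nat.cast_le.mpr (nbrCount_le_degree (p.finite_neighborSet v) _)
  have h4 : (nbrCount G v (fun u => (initState (instInput ident col L d u)).out = none) : ℝ)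
      ≤ nodeDegree G v :=
    Nat.cast_le.mpr (nbrCount_le_degree (p.finite_neighborSet v) _)
  have hα' : (0 : ℝ) < α := by exact_mod_cast hα0
  have h5 := (hdef v).2.trans (mul_le_mul_of_nonneg_left h4 (by positivity))
  have h6 := mul_le_mul_of_nonneg_left h5 hS
  have h7 : S * (1 / α * (nodeDegree G v : ℝ)) ≤ nodeDegree G v := by
    rw [← mul_assoc, mul_one_div]
    exact mul_le_of_le_one_left (Nat.cast_nonneg _) ((div_le_one hα').mpr hα)
  linarith

/-- Phases are repeated. -/
noncomputable def phases (R : NetMap NodeState ℕ) (M : ℕ) (A : LocalAlgorithm NodeInput NodeOutput)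
    (T : ℕ) (S : ℝ) : ℕ → NetMap NodeState NodeState
  | 0 => fun _ _ _ s => s
  | k + 1 => fun _ _ p s => phase R M A T S p (phases R M A T S k p s)

theorem RunsIn.phases {R : NetMap NodeState ℕ} {TR : ℕ} (hR : RunsIn TR R) (M : ℕ)
    (A : LocalAlgorithm NodeInput NodeOutput) (T : ℕ) (S : ℝ) (k : ℕ) :
    RunsIn (k * (TR + M * (T + 3))) (_root_.phases R M A T S k) := by
  induction k with
  | zero => rw [Nat.zero_mul]; exact RunsIn.pure id
  | succ k ih => rw [Nat.succ_mul]; exact ih.comp (hR.phase M A T S)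

/-- Increasing the slack from `1` to `2`: a node that is not colored in a phase has, in the end,
less than half as many uncolored neighbors as before, because at most a quarter of its uncolored
neighbors are in its class. -/
theorem TA_one_le {𝒢 : GraphClass} (h𝒢 : 𝒢.Hereditary) {Δ q N C M R T k : ℕ}
    (hk : Δ + 1 < 2 ^ k) (hR : ReducesColors q M R (1 / (4 : ℕ)))
    {A : LocalAlgorithm NodeInput NodeOutput} (hA : A.SolvesPA T 𝒢 Δ q N 2 C) :
    TA 𝒢 Δ q N 1 C ≤ (k * (R + M * (T + 3)) : ℕ) := by
  obtain ⟨F, hF, hF'⟩ := exists_defective_classes hR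
  refine TA_le_of_phases (hF.phases M A T 2 k) fun V _ G hG hΔ p ident col L d hL hslack => ?_
  set s₀ : V → NodeState := fun v => initState (instInput ident col L d v) with hs₀
  have key : ∀ k, IsConsistent p ident col L d (phases F M A T 2 k p s₀) ∧
      ∀ v, (phases F M A T 2 k p s₀ v).out = none →
        2 ^ k * (nbrCount G v (fun u => (phases F M A T 2 k p s₀ u).out = none) + 1)
          ≤ nodeDegree G v + 1 := by
    intro k
    induction k with
    | zero =>
      refine ⟨isConsistent_initState p ident col L d, fun v _ => ?_⟩
      have := nbrCount_le_degree (p.finite_neighborSet v)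
        (fun u => (phases F M A T 2 0 p s₀ u).out = none)
      omega
    | succ k ih =>
      obtain ⟨ih1, ih2⟩ := ih
      have hdef := hF' p N ident col L d _ ih1
      refine ⟨ih1.phase hA zero_le_two hΔ hL
        fun W _ => h𝒢 V W G _ ⟨SimpleGraph.Embedding.induce W⟩ hG, fun v hv => ?_⟩
      have h1 := ih1.weight_le_of_phase zero_le_two (hdef v).1 hv
      have h2 := hslack v
      have h3 := ih2 v (phase_out_eq_none hv)
      have h4 := nbrCount_add_not (p.finite_neighborSet v)
        (fun u => (phase F M A T 2 p (phases F M A T 2 k p s₀) u).out = none)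
      have h5 : ((nbrCount G v (fun u => (phase F M A T 2 p (phases F M A T 2 k p s₀) u).out = none)
          : ℕ) : ℝ) + (nbrCount G v
          (fun u => ¬ (phase F M A T 2 p (phases F M A T 2 k p s₀) u).out = none) : ℕ)
          = nodeDegree G v := by exact_mod_cast h4
      have h6 := (hdef v).2
      have h7 : 2 * nbrCount G v
          (fun u => (phase F M A T 2 p (phases F M A T 2 k p s₀) u).out = none)
          < nbrCount G v (fun u => (phases F M A T 2 k p s₀ u).out = none) := by
        have : (2 : ℝ) * nbrCount G v
          (fun u => (phase F M A T 2 p (phases F M A T 2 k p s₀) u).out = none)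
          < nbrCount G v (fun u => (phases F M A T 2 k p s₀ u).out = none) := by
          push_cast at h6
          linarith
        exact_mod_cast this
      change 2 ^ (k + 1) * (nbrCount G v
        (fun u => (phase F M A T 2 p (phases F M A T 2 k p s₀) u).out = none) + 1) ≤ _
      rw [pow_succ, mul_assoc]
      exact (Nat.mul_le_mul_left _ (by omega)).trans h3
  refine ⟨(key k).1, fun v hv => ?_⟩
  have h1 := (key k).2 v hv
  have h2 := hΔ v
  have h3 : 2 ^ k ≤ 2 ^ k * (nbrCount G v (fun u => (phases F M A T 2 k p s₀ u).out = none) + 1) :=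
    Nat.le_mul_of_pos_right _ (Nat.succ_pos _)
  omega

/-! ### The bounds in closed form -/

/-- At the cost of `O(log* q)` rounds, the initial coloring can be given `O(Δ²)` colors. -/
theorem TA_le_min_colors {K : ℕ}
    (hK : ∀ α : ℕ, 1 ≤ α → ∀ m : ℕ, ReducesColors m (K * α ^ 2) (2 * logStar m + 1) (1 / α))
    {𝒢 : GraphClass} {Δ q N C : ℕ} {S : ℝ} (hΔ : 1 ≤ Δ) :
    TA 𝒢 Δ q N S C
      ≤ TA 𝒢 Δ (min q (4 * K * Δ ^ 2)) N S C + (2 * logStar q + 1 : ℕ) := by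
  rcases le_total q (4 * K * Δ ^ 2) with h | h
  · rw [min_eq_left h]
    exact le_self_add
  · rw [min_eq_right h]
    refine TA_le_add_of_reducesColors ((hK (Δ + 1) (by omega) q).weaken ?_ le_rfl le_rfl)
    have : (Δ + 1) ^ 2 ≤ 4 * Δ ^ 2 := by nlinarith
    calc K * (Δ + 1) ^ 2 ≤ K * (4 * Δ ^ 2) := Nat.mul_le_mul_left K this
      _ = 4 * K * Δ ^ 2 := by ring

theorem toENNReal_le_of_le_natCast {a : ℕ∞} {n : ℕ} {x : ℝ} (h : a ≤ n) (hx : (n : ℝ) ≤ x) :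
    (a : ℝ≥0∞) ≤ ENNReal.ofReal x := by
  refine (ENat.toENNReal_le.mpr h).trans ?_
  rw [ENat.toENNReal_coe, ← ENNReal.ofReal_natCast]
  exact ENNReal.ofReal_le_ofReal hx

/-- The bound for slack `1` in terms of slack `2`, for all sufficiently large constants `c`. -/
theorem TA_one_bound {K r : ℕ} (hK1 : 1 ≤ K)
    (hK : ∀ α : ℕ, 1 ≤ α → ∀ m : ℕ, ReducesColors m (K * α ^ 2) (2 * logStar m + 1) (1 / α))
    (hr : ∀ n : ℕ, 2 ≤ n → logStar (4 * K * n ^ 2) ≤ r * logStar n)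
    {𝒢 : GraphClass} (h𝒢 : 𝒢.Hereditary) (Δ q N C : ℕ) {c : ℕ} (hc : 6 * r + 256 * K + 3 ≤ c) :
    (TA 𝒢 Δ q N 1 C : ℝ≥0∞) ≤
      (c : ℝ≥0∞) * ENNReal.ofReal (Real.logb 2 (Δ : ℝ)) *
          ((TA 𝒢 Δ (min q (c * Δ ^ 2)) N 2 C : ℝ≥0∞) + (logStar Δ : ℝ≥0∞))
        + (c : ℝ≥0∞) * (logStar q : ℝ≥0∞) := by
  by_cases hq : q ≤ 1
  · simp [TA_eq_zero_of_color_le_one hq]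
  have hq1 : 1 ≤ logStar q := one_le_logStar (by omega)
  rcases Nat.lt_or_ge Δ 2 with hΔ | hΔ
  · obtain rfl | rfl : Δ = 0 ∨ Δ = 1 := by omega
    · simp [TA_eq_zero_of_degree_zero]
    · -- As `log 1 = 0`, the first summand vanishes; `O(1)` colors are processed greedily.
      have h1 := TA_le_min_colors hK (𝒢 := 𝒢) (q := q) (N := N) (C := C) (S := 1) le_rfl
      have h2 : TA 𝒢 1 q N 1 C ≤ (3 * (4 * K) + (2 * logStar q + 1) : ℕ) := by
        refine h1.trans ?_
        rw [Nat.cast_add (3 * (4 * K))]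
        refine add_le_add_left ?_ _
        refine (TA_le_three_mul_colors le_rfl).trans (Nat.cast_le.mpr ?_)
        exact Nat.mul_le_mul_left 3 ((min_le_right _ _).trans (by simp))
      have h3 : 3 * (4 * K) + (2 * logStar q + 1) ≤ c * logStar q := by nlinarith
      refine le_trans (toENNReal_le_of_le_natCast h2 (x := c * logStar q) ?_) ?_
      · exact_mod_cast h3
      · rw [ENNReal.ofReal_mul (by positivity), ENNReal.ofReal_natCast, ENNReal.ofReal_natCast]
        exact le_add_self
  have hΔ' : (2 : ℝ) ≤ Δ := by exact_mod_cast hΔ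
  have hlog : 1 ≤ Real.logb 2 Δ := by
    rw [Real.le_logb_iff_rpow_le one_lt_two (by linarith)]
    simpa using hΔ'
  have hΔ1 := one_le_logStar hΔ
  by_cases htop : TA 𝒢 Δ (min q (c * Δ ^ 2)) N 2 C = ⊤
  · rw [htop, ENat.toENNReal_top, top_add, ENNReal.mul_top, top_add]
    · exact le_top
    · refine mul_ne_zero (by simp; omega) ?_
      simp only [ne_eq, ENNReal.ofReal_eq_zero, not_le]
      linarith
  obtain ⟨T', A', hA', hT'⟩ := exists_solvesPA_of_TA_ne_top htop
  have hmin : min q (4 * K * Δ ^ 2) ≤ min q (c * Δ ^ 2) :=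
    min_le_min_left q (Nat.mul_le_mul_right _ (by omega))
  have hle := (TA_mono_colors (𝒢 := 𝒢) (Δ := Δ) (N := N) (C := C) (S := 2) hmin).trans_eq hT'
  obtain ⟨T, A, hA, hT⟩ := exists_solvesPA_of_TA_ne_top (ne_top_of_le_ne_top (by simp) hle)
  rw [hT, Nat.cast_le] at hle
  set Q := min q (4 * K * Δ ^ 2) with hQ
  have hk : Δ + 1 < 2 ^ (Nat.log 2 Δ + 2) := by
    have := Nat.lt_pow_succ_log_self one_lt_two Δ
    rw [pow_succ]
    omega
  have h1 := TA_one_le h𝒢 hk (hK 4 (by norm_num) Q) hA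
  have h2 := (TA_le_min_colors hK (𝒢 := 𝒢) (q := q) (N := N) (C := C) (S := 1)
    (by omega : 1 ≤ Δ)).trans (add_le_add_left h1 _)
  rw [← Nat.cast_add] at h2
  have hQle : logStar Q ≤ r * logStar Δ := (logStar_mono (min_le_right _ _)).trans (hr Δ hΔ)
  have h3 : 2 * logStar Q + 1 + K * 4 ^ 2 * (T + 3) ≤ (2 * r + 64 * K + 1) * (T' + logStar Δ) := by
    nlinarith [Nat.mul_le_mul_left K hle, Nat.mul_le_mul_left K hΔ1, Nat.zero_le (r * T'),
      Nat.zero_le (K * T')]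
  have hlog2 : ((Nat.log 2 Δ + 2 : ℕ) : ℝ) ≤ 3 * Real.logb 2 Δ := by
    have : (Nat.log 2 Δ : ℝ) ≤ Real.logb 2 Δ := by
      rw [Real.le_logb_iff_rpow_le one_lt_two (by linarith), Real.rpow_natCast]
      exact_mod_cast Nat.pow_log_le_self 2 (by omega)
    push_cast
    linarith
  refine le_trans (toENNReal_le_of_le_natCast h2
    (x := c * Real.logb 2 Δ * (T' + logStar Δ) + c * logStar q) ?_) ?_
  · rw [Nat.cast_add]
    refine add_le_add ?_ ?_
    · rw [Nat.cast_mul]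
      have h4 : ((2 * logStar Q + 1 + K * 4 ^ 2 * (T + 3) : ℕ) : ℝ)
          ≤ (2 * r + 64 * K + 1) * (T' + logStar Δ) := by exact_mod_cast h3
      have h5 : (3 : ℝ) * (2 * r + 64 * K + 1) ≤ c := by
        exact_mod_cast (by omega : 3 * (2 * r + 64 * K + 1) ≤ c)
      have h6 : (0 : ℝ) ≤ Real.logb 2 Δ * (T' + logStar Δ) := by positivity
      calc ((Nat.log 2 Δ + 2 : ℕ) : ℝ) * _
          ≤ (3 * Real.logb 2 Δ) * ((2 * r + 64 * K + 1) * (T' + logStar Δ)) :=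
            mul_le_mul hlog2 h4 (Nat.cast_nonneg _) (by linarith)
        _ = (3 * (2 * r + 64 * K + 1)) * (Real.logb 2 Δ * (T' + logStar Δ)) := by ring
        _ ≤ c * (Real.logb 2 Δ * (T' + logStar Δ)) := mul_le_mul_of_nonneg_right h5 h6
        _ = c * Real.logb 2 Δ * (T' + logStar Δ) := by ring
    · have : 2 * logStar q + 1 ≤ c * logStar q := by nlinarith
      exact_mod_cast this
  · rw [hT', ENNReal.ofReal_add (by positivity) (by positivity), ENNReal.ofReal_mul (by positivity),
      ENNReal.ofReal_mul (by positivity), ENNReal.ofReal_mul (by positivity),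
      ENNReal.ofReal_add (by positivity) (by positivity)]
    simp only [ENNReal.ofReal_natCast, ENat.toENNReal_coe]
    exact le_rfl

/-- The bound for slack `2` in terms of slack `S`, for all sufficiently large constants `c`. -/
theorem TA_two_bound {K : ℕ} (hK1 : 1 ≤ K)
    (hK : ∀ α : ℕ, 1 ≤ α → ∀ m : ℕ, ReducesColors m (K * α ^ 2) (2 * logStar m + 1) (1 / α))
    {𝒢 : GraphClass} (h𝒢 : 𝒢.Hereditary) (Δ q N C : ℕ) {c : ℕ} (hc : 16 * K + 6 ≤ c)
    {S : ℝ} (hS : 1 ≤ S) :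
    (TA 𝒢 Δ q N 2 C : ℝ≥0∞) ≤
      (c : ℝ≥0∞) * ENNReal.ofReal (S ^ 2) *
          (TA 𝒢 Δ (min q (c * Δ ^ 2)) N S C : ℝ≥0∞)
        + (c : ℝ≥0∞) * (logStar q : ℝ≥0∞) := by
  by_cases hq : q ≤ 1
  · simp [TA_eq_zero_of_color_le_one hq]
  have hq1 : 1 ≤ logStar q := one_le_logStar (by omega)
  by_cases hsmall : q ≤ 2 ∨ N ≤ 2
  · have h1 : TA 𝒢 Δ q N 2 C ≤ (6 : ℕ) := by
      rcases hsmall with h | h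
      · exact (TA_le_three_mul_colors one_le_two).trans (Nat.cast_le.mpr (by omega))
      · exact (TA_le_three_mul_idents one_le_two).trans (Nat.cast_le.mpr (by omega))
    refine le_trans (toENNReal_le_of_le_natCast h1 (x := c * logStar q) ?_) ?_
    · exact_mod_cast (by nlinarith : 6 ≤ c * logStar q)
    · rw [ENNReal.ofReal_mul (by positivity), ENNReal.ofReal_natCast, ENNReal.ofReal_natCast]
      exact le_add_self
  push Not at hsmall
  rcases Nat.eq_zero_or_pos Δ with rfl | hΔ
  · simp [TA_eq_zero_of_degree_zero]
  rcases Nat.eq_zero_or_pos C with rfl | hC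
  · have : TA 𝒢 Δ q N 2 0 = 0 := TA_eq_zero fun V _ G _ _ _ _ L d hL hslack u v _ => by
      have h1 := list_nonempty_of_hasSlack hslack (v := u) (by positivity)
      have h2 := hL u
      rw [Finset.range_zero, Finset.subset_empty] at h2
      exact h1.ne_empty h2
    simp [this]
  by_cases hedge : ∀ (V : Type) (G : SimpleGraph V), 𝒢 V G → ∀ u v, ¬ G.Adj u v
  · have : TA 𝒢 Δ q N 2 C = 0 := TA_eq_zero fun V _ G hG _ _ _ _ _ _ _ => hedge V G hG
    simp [this]
  push Not at hedge
  obtain ⟨V₀, G₀, hG₀, a, b, hab⟩ := hedge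
  by_cases htop : TA 𝒢 Δ (min q (c * Δ ^ 2)) N S C = ⊤
  · rw [htop, ENat.toENNReal_top, ENNReal.mul_top, top_add]
    · exact le_top
    · refine mul_ne_zero (by simp; omega) ?_
      simp only [ne_eq, ENNReal.ofReal_eq_zero, not_le]
      positivity
  obtain ⟨T', A', hA', hT'⟩ := exists_solvesPA_of_TA_ne_top htop
  -- Since zero rounds do not suffice, the overhead of `O(1)` rounds per class is affordable.
  have hT1 : 1 ≤ T' := by
    by_contra h
    obtain rfl : T' = 0 := by omega
    refine not_solvesPA_zero h𝒢 hΔ (le_min (by omega) ?_) (by omega) hC hG₀ hab A' hA'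
    nlinarith [Nat.pow_le_pow_left hΔ 2]
  have hmin : min q (4 * K * Δ ^ 2) ≤ min q (c * Δ ^ 2) :=
    min_le_min_left q (Nat.mul_le_mul_right _ (by omega))
  have hle := (TA_mono_colors (𝒢 := 𝒢) (Δ := Δ) (N := N) (C := C) (S := S) hmin).trans_eq hT'
  obtain ⟨T, A, hA, hT⟩ := exists_solvesPA_of_TA_ne_top (ne_top_of_le_ne_top (by simp) hle)
  rw [hT, Nat.cast_le] at hle
  set Q := min q (4 * K * Δ ^ 2) with hQ
  have hα0 : 1 ≤ ⌈S⌉₊ := Nat.one_le_ceil_iff.mpr (by linarith)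
  have h1 := TA_two_le h𝒢 (by linarith) (Nat.le_ceil S) hα0 (hK _ hα0 Q) hA
  have h2 := (TA_le_min_colors hK (𝒢 := 𝒢) (q := q) (N := N) (C := C) (S := 2) hΔ).trans
    (add_le_add_left h1 _)
  rw [← Nat.cast_add] at h2
  have hQle : logStar Q ≤ logStar q := logStar_mono (min_le_left _ _)
  have hα2 : ((⌈S⌉₊ : ℕ) : ℝ) ≤ 2 * S := by
    have := Nat.ceil_lt_add_one (by linarith : 0 ≤ S)
    linarith
  have h3 : 2 * logStar Q + 1 + (2 * logStar q + 1) ≤ c * logStar q := by nlinarith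
  refine le_trans (toENNReal_le_of_le_natCast h2
    (x := c * S ^ 2 * T' + c * logStar q) ?_) ?_
  · have h4 : ((2 * logStar Q + 1 + (2 * logStar q + 1) : ℕ) : ℝ) ≤ c * logStar q := by
      exact_mod_cast h3
    have h5 : ((⌈S⌉₊ : ℕ) : ℝ) ^ 2 ≤ 4 * S ^ 2 := by
      calc ((⌈S⌉₊ : ℕ) : ℝ) ^ 2 ≤ (2 * S) ^ 2 := pow_le_pow_left₀ (Nat.cast_nonneg _) hα2 2
        _ = 4 * S ^ 2 := by ring
    have h6 : ((T + 3 : ℕ) : ℝ) ≤ 4 * T' := by exact_mod_cast (by omega : T + 3 ≤ 4 * T')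
    have h7 : (K : ℝ) * 16 ≤ c := by exact_mod_cast (by omega : K * 16 ≤ c)
    have h8 : ((K * ⌈S⌉₊ ^ 2 * (T + 3) : ℕ) : ℝ) ≤ c * S ^ 2 * T' := by
      calc ((K * ⌈S⌉₊ ^ 2 * (T + 3) : ℕ) : ℝ) = K * (⌈S⌉₊ : ℝ) ^ 2 * (T + 3 : ℕ) := by
            push_cast; ring
        _ ≤ K * (4 * S ^ 2) * (4 * T') := by gcongr
        _ = K * 16 * (S ^ 2 * T') := by ring
        _ ≤ c * (S ^ 2 * T') := mul_le_mul_of_nonneg_right h7 (by positivity)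
        _ = c * S ^ 2 * T' := by ring
    push_cast at h4 h8 ⊢
    linarith
  · rw [hT', ENNReal.ofReal_add (by positivity) (by positivity), ENNReal.ofReal_mul (by positivity),
      ENNReal.ofReal_mul (by positivity), ENNReal.ofReal_mul (by positivity)]
    simp only [ENNReal.ofReal_natCast, ENat.toENNReal_coe]
    exact le_rfl

theorem mainTheorem4 :
    ∃ c : ℕ, ∀ (𝒢 : GraphClass), 𝒢.Hereditary → ∀ (Δ q N C : ℕ),
      ((TA 𝒢 Δ q N 1 C : ℝ≥0∞) ≤
        (c : ℝ≥0∞) * ENNReal.ofReal (Real.logb 2 (Δ : ℝ)) *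
            ((TA 𝒢 Δ (min q (c * Δ ^ 2)) N 2 C : ℝ≥0∞) + (logStar Δ : ℝ≥0∞))
          + (c : ℝ≥0∞) * (logStar q : ℝ≥0∞)) ∧
      (∀ S : ℝ, 1 ≤ S →
        (TA 𝒢 Δ q N 2 C : ℝ≥0∞) ≤
          (c : ℝ≥0∞) * ENNReal.ofReal (S ^ 2) *
              (TA 𝒢 Δ (min q (c * Δ ^ 2)) N S C : ℝ≥0∞)
            + (c : ℝ≥0∞) * (logStar q : ℝ≥0∞)) := by
  obtain ⟨K, hK1, hK⟩ := exists_reducesColors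
  obtain ⟨r, hr⟩ := exists_logStar_mul_sq_le (4 * K)
  refine ⟨6 * r + 256 * K + 6, fun 𝒢 h𝒢 Δ q N C => ⟨?_, fun S hS => ?_⟩⟩
  · exact TA_one_bound hK1 hK hr h𝒢 Δ q N C (by omega)
  · exact TA_two_bound hK1 hK h𝒢 Δ q N C (by omega) hS
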